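/- Let $K$ be a field of characteristic $0$, let $n, r, s \ge 1$ be integers with $r \mid s$, and let $R = K[x_1,\dots,x_n]$ with its standard grading. Let $e_i$ denote the elementary symmetric polynomial of degree $i$ in $n$ variables, and put $$f_i = e_i(x_1^r,\dots,x_n^r)\quad (1\le i\le n-1), \qquad f_n = e_n(x_1^s,\dots,x_n^s),$$ $I = (f_1,\dots,f_n)$ and $A = R/I$. Let $z$ be the image of $x_n$ in $A$, and write $0:z^k = \{a\in A : a z^k = 0\}$. Then for every integer $k$ with $1 \le k < sn$ the graded algebra $B = A/(0:z^k)$ is an Artinian complete intersection, i.e. $B$ is finite-dimensional over $K$ and the kernel of $R \to B$ is generated by a regular sequence of $n$ homogeneous polynomials of positive degree, and $B$ has the strong Lefschetz property: writing $B = \bigoplus_{i=0}^c B_i$ with $B_c \neq 0$, there is a linear form $g \in B_1$ such that the multiplication map $$\times g^{c-2i} : B_i \longrightarrow B_{c-i}$$ is bijective for all $i = 0,1,\dots,\lfloor c/2\rfloor$. -/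

import Mathlib

open MvPolynomial

noncomputable section

/-! ### Gradings on quotients -/

section Grading

variable {K : Type*} [Field K] {A : Type*} [CommRing A] [Algebra K A]

/-- The grading induced on `A ⧸ J` by a grading `𝒜` of `A`: the degree `i` part is the image of
`𝒜 i`. -/
def quotientGrading (𝒜 : ℕ → Submodule K A) (J : Ideal A) (i : ℕ) : Submodule K (A ⧸ J) :=
  (𝒜 i).map (Ideal.Quotient.mkₐ K J).toLinearMap

theorem quotientGrading_isInternal (𝒜 : ℕ → Submodule K A) [GradedAlgebra 𝒜] (J : Ideal A)
    (hJ : J.IsHomogeneous 𝒜) : DirectSum.IsInternal (quotientGrading 𝒜 J) := by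
  classical
  constructor
  · rw [injective_iff_map_eq_zero]
    intro b hb
    have hex : ∀ i, ∃ a ∈ 𝒜 i, Ideal.Quotient.mk J a = (b i : A ⧸ J) := fun i => (b i).2
    choose a ha hab using hex
    have h0 : Ideal.Quotient.mk J (∑ i ∈ DFinsupp.support b, a i) = 0 := by
      rw [map_sum, ← hb, DirectSum.coeAddMonoidHom_eq_dfinsuppSum]
      exact Finset.sum_congr rfl fun i _ => hab i
    rw [Ideal.Quotient.eq_zero_iff_mem] at h0
    ext i
    by_cases hi : i ∈ DFinsupp.support b
    · have h1 := hJ i h0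
      have h2 : (DirectSum.decompose 𝒜 (∑ j ∈ DFinsupp.support b, a j) i : A) = a i := by
        rw [DirectSum.decompose_sum, DFinsupp.finsetSum_apply, AddSubmonoidClass.coe_finsetSum,
          Finset.sum_eq_single i]
        · exact DirectSum.decompose_of_mem_same 𝒜 (ha i)
        · intro j _ hji
          exact DirectSum.decompose_of_mem_ne 𝒜 (ha j) hji
        · exact fun h => absurd hi h
      rw [h2] at h1
      rw [← hab i]
      simpa using Ideal.Quotient.eq_zero_iff_mem.mpr h1
    · rw [DFinsupp.notMem_support_iff.mp hi]
      rfl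
  · intro y
    obtain ⟨x, rfl⟩ := Ideal.Quotient.mk_surjective y
    rw [← DirectSum.sum_support_decompose 𝒜 x, map_sum]
    refine ⟨∑ i ∈ (DirectSum.decompose 𝒜 x).support,
      DirectSum.of (fun i => quotientGrading 𝒜 J i) i
        ⟨Ideal.Quotient.mk J (DirectSum.decompose 𝒜 x i), ⟨_, SetLike.coe_mem _, rfl⟩⟩, ?_⟩
    rw [map_sum]
    exact Finset.sum_congr rfl fun i _ => by rw [DirectSum.coeAddMonoidHom_of]

/-- The quotient of a graded algebra by a homogeneous ideal is a graded algebra. -/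
abbrev quotientGradedAlgebra (𝒜 : ℕ → Submodule K A) [GradedAlgebra 𝒜] (J : Ideal A)
    (hJ : J.IsHomogeneous 𝒜) : GradedAlgebra (quotientGrading 𝒜 J) where
  one_mem := ⟨1, SetLike.GradedOne.one_mem, map_one (Ideal.Quotient.mkₐ K J)⟩
  mul_mem := by
    rintro i j _ _ ⟨a, ha, rfl⟩ ⟨b, hb, rfl⟩
    exact ⟨a * b, SetLike.GradedMul.mul_mem ha hb, map_mul (Ideal.Quotient.mkₐ K J) a b⟩
  toDecomposition := (quotientGrading_isInternal 𝒜 J hJ).chooseDecomposition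

/-- The ideal `0 : x = {a | a x = 0}` of a homogeneous element `x` is homogeneous. -/
theorem isHomogeneous_bot_colon (𝒜 : ℕ → Submodule K A) [GradedAlgebra 𝒜] {d : ℕ} {x : A}
    (hx : x ∈ 𝒜 d) : ((⊥ : Ideal A).colon {x}).IsHomogeneous 𝒜 := by
  intro i a ha
  simp only [Submodule.mem_colon_singleton, smul_eq_mul, Submodule.mem_bot] at ha ⊢
  rw [← DirectSum.coe_decompose_mul_add_of_right_mem 𝒜 hx, ha]
  simp

/-- The strong Lefschetz property of a graded algebra `A = ⨁_{i=0}^c A_i` with `A_c ≠ 0`: there is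
a linear form `g ∈ A_1` such that multiplication by `g ^ (c - 2 i)` is a bijection from `A_i` to
`A_{c-i}` for every `i` with `0 ≤ i ≤ ⌊c / 2⌋`. -/
def HasSLP (𝒜 : ℕ → Submodule K A) [GradedAlgebra 𝒜] : Prop :=
  ∃ c : ℕ, 𝒜 c ≠ ⊥ ∧ (∀ i, c < i → 𝒜 i = ⊥) ∧
    ∃ g ∈ 𝒜 1, ∀ i, i ≤ c / 2 →
      Set.BijOn (fun a : A => g ^ (c - 2 * i) * a) (𝒜 i : Set A) (𝒜 (c - i) : Set A)

end Grading

/-! ### Complete intersections -/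

/-- An ideal `J` of `K[x_1, …, x_n]` is an Artinian graded complete intersection ideal (a complete
intersection ideal of height `n`): it is generated by a regular sequence of `n` homogeneous
polynomials of positive degree. -/
def IsCompleteIntersection {K : Type*} [Field K] {n : ℕ}
    (J : Ideal (MvPolynomial (Fin n) K)) : Prop :=
  ∃ F : Fin n → MvPolynomial (Fin n) K,
    (∀ i, ∃ d, 0 < d ∧ (F i).IsHomogeneous d) ∧
    RingTheory.Sequence.IsRegular (MvPolynomial (Fin n) K) (List.ofFn F) ∧
    J = Ideal.span (Set.range F)

/-! ### The algebra defined by power-substituted elementary symmetric polynomials -/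

section Symmetric

variable (K : Type*) [Field K] (n r s : ℕ)

/-- `e_d(x_1^r, …, x_n^r)`. -/
def esymmPow (d : ℕ) : MvPolynomial (Fin n) K :=
  aeval (fun j : Fin n => (X j : MvPolynomial (Fin n) K) ^ r) (esymm (Fin n) K d)

/-- The ideal `I = (f_1, …, f_n)`, where `f_d = e_d(x_1^r, …, x_n^r)` for `1 ≤ d ≤ n - 1` and
`f_n = e_n(x_1^s, …, x_n^s)`. -/
def symmIdeal : Ideal (MvPolynomial (Fin n) K) :=
  Ideal.span ({f | ∃ d, 1 ≤ d ∧ d < n ∧ f = esymmPow K n r d} ∪ {esymmPow K n s n})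

/-- The algebra `A = K[x_1, …, x_n] / I`. -/
def SymmAlgebra : Type _ := MvPolynomial (Fin n) K ⧸ symmIdeal K n r s

instance : CommRing (SymmAlgebra K n r s) :=
  inferInstanceAs (CommRing (MvPolynomial (Fin n) K ⧸ symmIdeal K n r s))

instance : Algebra K (SymmAlgebra K n r s) :=
  inferInstanceAs (Algebra K (MvPolynomial (Fin n) K ⧸ symmIdeal K n r s))

/-- The quotient map `K[x_1, …, x_n] → A`. -/
def symmMk : MvPolynomial (Fin n) K →ₐ[K] SymmAlgebra K n r s :=
  Ideal.Quotient.mkₐ K (symmIdeal K n r s)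

theorem esymmPow_isHomogeneous (d : ℕ) : (esymmPow K n r d).IsHomogeneous (r * d) := by
  unfold esymmPow
  rw [esymm, map_sum]
  refine IsHomogeneous.sum _ _ _ fun t ht => ?_
  rw [map_prod]
  have h := IsHomogeneous.prod t (fun i => aeval (fun j : Fin n =>
    (X j : MvPolynomial (Fin n) K) ^ r) (X i : MvPolynomial (Fin n) K)) (fun _ => r)
    (fun i _ => by rw [aeval_X]; exact isHomogeneous_X_pow i r)
  rwa [Finset.sum_const, (Finset.mem_powersetCard.mp ht).2, smul_eq_mul, mul_comm] at h

attribute [local instance] MvPolynomial.gradedAlgebra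

theorem symmIdeal_isHomogeneous :
    (symmIdeal K n r s).IsHomogeneous (homogeneousSubmodule (Fin n) K) := by
  refine Ideal.homogeneous_span _ _ ?_
  rintro f (⟨d, -, -, rfl⟩ | rfl)
  · exact ⟨_, esymmPow_isHomogeneous K n r d⟩
  · exact ⟨_, esymmPow_isHomogeneous K n s n⟩

/-- The standard grading of `A`. -/
def symmGrading : ℕ → Submodule K (SymmAlgebra K n r s) :=
  quotientGrading (homogeneousSubmodule (Fin n) K) (symmIdeal K n r s)

instance : GradedAlgebra (symmGrading K n r s) :=
  quotientGradedAlgebra _ _ (symmIdeal_isHomogeneous K n r s)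

variable {n}

/-- The image `x̄_j` of the variable `x_j` in `A`. -/
def symmVar (j : Fin n) : SymmAlgebra K n r s :=
  symmMk K n r s (X j)

/-- The ideal `0 : x̄_j^k` of `A`. -/
def annVarPow (j : Fin n) (k : ℕ) : Ideal (SymmAlgebra K n r s) :=
  (⊥ : Ideal (SymmAlgebra K n r s)).colon {symmVar K r s j ^ k}

theorem symmVar_mem (j : Fin n) : symmVar K r s j ∈ symmGrading K n r s 1 :=
  ⟨X j, isHomogeneous_X K j, rfl⟩

theorem annVarPow_isHomogeneous (j : Fin n) (k : ℕ) :
    (annVarPow K r s j k).IsHomogeneous (symmGrading K n r s) :=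
  isHomogeneous_bot_colon (symmGrading K n r s) (SetLike.pow_mem_graded k (symmVar_mem K r s j))

/-- The standard grading of `A / (0 : x̄_j^k)`. -/
def annVarPowGrading (j : Fin n) (k : ℕ) :
    ℕ → Submodule K (SymmAlgebra K n r s ⧸ annVarPow K r s j k) :=
  quotientGrading (symmGrading K n r s) (annVarPow K r s j k)

instance (j : Fin n) (k : ℕ) : GradedAlgebra (annVarPowGrading K r s j k) :=
  quotientGradedAlgebra _ _ (annVarPow_isHomogeneous K r s j k)

end Symmetric

end

/-!
Write `y_i = x_i ^ r`. Modulo `e_1(y), …, e_{n-1}(y)` the polynomial `∏ (T - y_i)` is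
`T ^ n ± e_n(y)`, so that `e_n(x_1^s, …, x_n^s)`, a power of `e_n(y)` since `r ∣ s`, is
`± x_n ^ (s n)`. Moreover `e_1(y), …, e_{n-1}(y)` generate the same ideal as the complete
homogeneous functions `h_1(y_1, …, y_n)`, `h_2(y_2, …, y_n)`, …, `h_{n-1}(y_{n-1}, y_n)`, because
`∏_{all i} (1 - y_i T) / ∏_{i ≥ j} (1 - y_i T)` is a polynomial of degree `j - 1`
(`span_range_triangularSystem`). So `I` is generated by `x_n ^ (s n)` and polynomials each of which
is monic in a new variable: a triangular system (`IsTriangular`). Dividing by monic polynomials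
shows that `I : x_n ^ k` is generated by the system in which `x_n ^ (s n)` is replaced by
`x_n ^ (s n - k)` (`comap_annVarPow_last`).

It remains to see that a triangular system of homogeneous polynomials of positive degree is a
regular sequence, which holds since monic polynomials are nonzerodivisors, and that its quotient is
finite-dimensional with the strong Lefschetz property. The quotient is a tower of extensions
`A[X] / (p)` with `p` monic and homogeneous of degree `d`, so it suffices that such an extension
inherits the property from `A` (`IsLefschetz.exists_of_polynomial`). For `p = X ^ d` this is a short
argument with derivatives (`X_pow_dvd_of_C_add_X_pow_mul`). In general the polynomials
`p_ε(X) = ε ^ d p(X / ε)` degenerate to `X ^ d` at `ε = 0`; the strong Lefschetz condition says that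
certain determinants, polynomial in `ε`, do not vanish, so it holds for `p_ε` with some `ε ≠ 0`,
and rescaling `X` carries it to `p`.
-/

noncomputable section

/-! ### Strong Lefschetz elements -/

section SLP

variable {K : Type*} [Field K] {A : Type*} [CommRing A] [Algebra K A]

/-- `g` is a strong Lefschetz element for the pieces `𝒜 0, …, 𝒜 c`. Bijectivity of the maps
`g ^ (c - 2 * i) : 𝒜 i → 𝒜 (c - i)` is recorded as injectivity together with the symmetry of the
Hilbert function. Nothing is assumed about how the pieces sit in `A`, so that the notion can be
used for images of a grading. -/
structure IsLefschetz (𝒜 : ℕ → Submodule K A) (c : ℕ) (g : A) : Prop where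
  mem : g ∈ 𝒜 1
  top_ne_bot : 𝒜 c ≠ ⊥
  eq_bot : ∀ i, c < i → 𝒜 i = ⊥
  finrank_eq : ∀ i j, i + j = c → Module.finrank K (𝒜 i) = Module.finrank K (𝒜 j)
  injective : ∀ i m, 2 * i + m = c → ∀ a ∈ 𝒜 i, g ^ m * a = 0 → a = 0

theorem IsLefschetz.bijOn [FiniteDimensional K A] {𝒜 : ℕ → Submodule K A}
    [SetLike.GradedMonoid 𝒜] {c : ℕ} {g : A} (h : IsLefschetz 𝒜 c g) {i : ℕ} (hi : i ≤ c / 2) :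
    Set.BijOn (fun a : A => g ^ (c - 2 * i) * a) (𝒜 i : Set A) (𝒜 (c - i) : Set A) := by
  have hm : ∀ a ∈ 𝒜 i, LinearMap.mulLeft K (g ^ (c - 2 * i)) a ∈ 𝒜 (c - i) := fun a ha => by
    have := SetLike.mul_mem_graded (SetLike.pow_mem_graded (c - 2 * i) h.mem) ha
    rwa [show (c - 2 * i) • 1 + i = c - i by simp; omega] at this
  have hinj : Function.Injective ((LinearMap.mulLeft K (g ^ (c - 2 * i))).restrict hm) := by
    rw [injective_iff_map_eq_zero]
    rintro ⟨a, ha⟩ h0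
    exact Subtype.ext (h.injective i _ (by omega) a ha (congrArg Subtype.val h0))
  have hsurj := (LinearMap.injective_iff_surjective_of_finrank_eq_finrank
    (h.finrank_eq i (c - i) (by omega))).mp hinj
  refine ⟨hm, fun a ha b hb hab => ?_, fun b hb => ?_⟩
  · exact congrArg Subtype.val (@hinj ⟨a, ha⟩ ⟨b, hb⟩ (Subtype.ext hab))
  · obtain ⟨a, ha⟩ := hsurj ⟨b, hb⟩
    exact ⟨a, a.2, congrArg Subtype.val ha⟩

/-! ### Polynomial families of linear maps -/

variable (K) in
/-- The functions `K → M` of the form `ε ↦ ∑ k, ε ^ k • w k` (finite sums). -/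
def polynomialFamilies (M : Type*) [AddCommGroup M] [Module K M] : Submodule K (K → M) :=
  Submodule.span K {u | ∃ (k : ℕ) (w : M), u = fun ε => ε ^ k • w}

section Families

variable {M N : Type*} [AddCommGroup M] [Module K M] [AddCommGroup N] [Module K N]

theorem const_mem_polynomialFamilies (w : M) : (fun _ => w) ∈ polynomialFamilies K M :=
  Submodule.subset_span ⟨0, w, by simp⟩

theorem map_mem_polynomialFamilies (f : M →ₗ[K] N) {u : K → M}
    (hu : u ∈ polynomialFamilies K M) : (fun ε => f (u ε)) ∈ polynomialFamilies K N := by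
  induction hu using Submodule.span_induction with
  | mem u hu =>
    obtain ⟨k, w, rfl⟩ := hu
    exact Submodule.subset_span ⟨k, f w, by simp⟩
  | zero => simpa using const_mem_polynomialFamilies (0 : N)
  | add u v _ _ h1 h2 =>
    simp only [Pi.add_apply, map_add]
    exact add_mem h1 h2
  | smul a u _ h =>
    simp only [Pi.smul_apply, map_smul]
    exact Submodule.smul_mem _ a h

theorem pow_smul_mem_polynomialFamilies (k : ℕ) {u : K → M}
    (hu : u ∈ polynomialFamilies K M) : (fun ε => ε ^ k • u ε) ∈ polynomialFamilies K M := by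
  induction hu using Submodule.span_induction with
  | mem u hu =>
    obtain ⟨l, w, rfl⟩ := hu
    exact Submodule.subset_span ⟨k + l, w, by simp [pow_add, mul_smul]⟩
  | zero => simpa using const_mem_polynomialFamilies (0 : M)
  | add u v _ _ h1 h2 =>
    simp only [Pi.add_apply, smul_add]
    exact add_mem h1 h2
  | smul a u _ h =>
    simp only [Pi.smul_apply, smul_comm _ a]
    exact Submodule.smul_mem _ a h

theorem exists_polynomial_of_mem {u : K → K} (hu : u ∈ polynomialFamilies K K) :
    ∃ P : Polynomial K, ∀ ε, P.eval ε = u ε := by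
  induction hu using Submodule.span_induction with
  | mem u hu =>
    obtain ⟨k, w, rfl⟩ := hu
    exact ⟨Polynomial.C w * Polynomial.X ^ k, fun ε => by simp [mul_comm w]⟩
  | zero => exact ⟨0, by simp⟩
  | add u v _ _ h1 h2 =>
    obtain ⟨P, hP⟩ := h1
    obtain ⟨Q, hQ⟩ := h2
    exact ⟨P + Q, by simp [hP, hQ]⟩
  | smul a u _ h =>
    obtain ⟨P, hP⟩ := h
    exact ⟨Polynomial.C a * P, by simp [hP]⟩

/-- Injectivity is an open condition: a polynomial family of linear maps on a finite-dimensional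
space that is injective at `0` is injective away from finitely many parameters. -/
theorem finite_setOf_not_injective [FiniteDimensional K M] (T : K → M →ₗ[K] N)
    (hT : ∀ v, (fun ε => T ε v) ∈ polynomialFamilies K N) (h0 : Function.Injective (T 0)) :
    {ε | ¬ Function.Injective (T ε)}.Finite := by
  classical
  obtain ⟨f, hf⟩ := (T 0).exists_leftInverse_of_injective (LinearMap.ker_eq_bot.mpr h0)
  -- composing with a left inverse `f` of `T 0` gives square matrices with polynomial entries
  let b := Module.finBasis K M
  have hP : ∀ i j, ∃ P : Polynomial K, ∀ ε, P.eval ε = b.repr (f (T ε (b j))) i := fun i j =>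
    exists_polynomial_of_mem (map_mem_polynomialFamilies (b.coord i ∘ₗ f) (hT (b j)))
  choose P hP using hP
  have hdet : ∀ ε, (Matrix.det (Matrix.of P)).eval ε = LinearMap.det (f ∘ₗ T ε) := fun ε => by
    rw [← LinearMap.det_toMatrix b, ← Polynomial.coe_evalRingHom, RingHom.map_det]
    congr 1
    ext i j
    simp [LinearMap.toMatrix_apply, hP]
  have hne : Matrix.det (Matrix.of P) ≠ 0 := fun h => by
    have := hdet 0
    rw [hf, h] at this
    simp at this
  refine (Polynomial.finite_setOfPred_isRoot hne).subset fun ε hε => ?_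
  by_contra hroot
  refine hε ?_
  have hu : IsUnit (LinearMap.det (f ∘ₗ T ε)) := by
    rw [isUnit_iff_ne_zero, ← hdet]
    exact hroot
  have := ((Module.End.isUnit_iff _).mp ((LinearMap.isUnit_iff_isUnit_det _).mpr hu)).injective
  rw [LinearMap.coe_comp] at this
  exact this.of_comp

end Families

/-! ### Graded pieces of a polynomial ring over a graded algebra -/

/-- The degree `i` part of `A[X]`, where `X` has degree `1`: the coefficient of `X ^ q` lies in
`𝒜 (i - q)` for `q ≤ i` and vanishes for `q > i`. -/
def polyGrading (𝒜 : ℕ → Submodule K A) (i : ℕ) : Submodule K (Polynomial A) where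
  carrier := {u | (∀ q j, q + j = i → u.coeff q ∈ 𝒜 j) ∧ ∀ q, i < q → u.coeff q = 0}
  add_mem' h1 h2 := ⟨fun q j h => by simpa using add_mem (h1.1 q j h) (h2.1 q j h),
    fun q h => by simp [h1.2 q h, h2.2 q h]⟩
  zero_mem' := by simp
  smul_mem' a u h := ⟨fun q j hq => by simpa using Submodule.smul_mem _ a (h.1 q j hq),
    fun q hq => by simp [h.2 q hq]⟩

variable {𝒜 : ℕ → Submodule K A}

theorem C_mul_X_pow_mem_polyGrading {a : A} {j q i : ℕ} (ha : a ∈ 𝒜 j) (h : q + j = i) :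
    Polynomial.C a * Polynomial.X ^ q ∈ polyGrading 𝒜 i := by
  constructor
  · intro q' j' h'
    rw [Polynomial.coeff_C_mul_X_pow]
    split_ifs with hq
    · rwa [show j' = j by omega]
    · exact zero_mem _
  · intro q' h'
    rw [Polynomial.coeff_C_mul_X_pow, if_neg (by omega)]

instance [SetLike.GradedMonoid 𝒜] : SetLike.GradedMonoid (polyGrading 𝒜) where
  one_mem := by
    simpa using C_mul_X_pow_mem_polyGrading (q := 0) (SetLike.GradedOne.one_mem (A := 𝒜)) rfl
  mul_mem := by
    intro i j u v hu hv
    constructor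
    · intro q l h
      rw [Polynomial.coeff_mul]
      refine sum_mem fun x hx => ?_
      have hx := Finset.HasAntidiagonal.mem_antidiagonal.mp hx
      by_cases h1 : i < x.1
      · simp [hu.2 _ h1]
      by_cases h2 : j < x.2
      · simp [hv.2 _ h2]
      have := SetLike.mul_mem_graded (hu.1 x.1 (i - x.1) (by omega))
        (hv.1 x.2 (j - x.2) (by omega))
      rwa [show i - x.1 + (j - x.2) = l by omega] at this
    · intro q h
      rw [Polynomial.coeff_mul]
      refine Finset.sum_eq_zero fun x hx => ?_
      have hx := Finset.HasAntidiagonal.mem_antidiagonal.mp hx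
      by_cases h1 : i < x.1
      · simp [hu.2 _ h1]
      · simp [hv.2 x.2 (by omega)]

theorem C_add_X_mem_polyGrading [SetLike.GradedMonoid 𝒜] {g : A} (hg : g ∈ 𝒜 1) (ε : K) :
    Polynomial.C g + ε • Polynomial.X ∈ polyGrading 𝒜 1 := by
  refine add_mem ?_ (Submodule.smul_mem _ _ ?_)
  · simpa using C_mul_X_pow_mem_polyGrading (q := 0) hg rfl
  · simpa using C_mul_X_pow_mem_polyGrading (q := 1) (SetLike.GradedOne.one_mem (A := 𝒜)) rfl

theorem derivative_mem_polyGrading {i : ℕ} {u : Polynomial A} (hu : u ∈ polyGrading 𝒜 (i + 1)) :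
    u.derivative ∈ polyGrading 𝒜 i := by
  constructor
  · intro q j h
    rw [Polynomial.coeff_derivative]
    have := Submodule.smul_mem _ ((q : K) + 1) (hu.1 (q + 1) j (by omega))
    rw [Algebra.smul_def] at this
    simpa [mul_comm] using this
  · intro q h
    rw [Polynomial.coeff_derivative, hu.2 _ (by omega), zero_mul]

theorem comp_C_mul_X_mem_polyGrading {i : ℕ} {u : Polynomial A} (hu : u ∈ polyGrading 𝒜 i)
    (ε : K) : u.comp (Polynomial.C (algebraMap K A ε) * Polynomial.X) ∈ polyGrading 𝒜 i := by
  constructor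
  · intro q j h
    rw [Polynomial.comp_C_mul_X_coeff, ← map_pow, mul_comm, ← Algebra.smul_def]
    exact Submodule.smul_mem _ _ (hu.1 q j h)
  · intro q h
    rw [Polynomial.comp_C_mul_X_coeff, hu.2 q h, zero_mul]

/-! ### Adjoining a nilpotent variable -/

/-- If `g` is a strong Lefschetz element of `A`, then `g + X` is one of `A[X] / (X ^ (d + 1))`.
The induction on `d` rests on the derivative: with `G = g + X`, if `X ^ (d + 2)` divides
`G ^ (m + 1) * u`, then `X ^ (d + 1)` divides `(m + 1) * G ^ m * u + G ^ (m + 1) * u'`, hence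
`G ^ (m + 2) * u'`, and the induction hypothesis applies first to `u'` and then to `u`. -/
theorem X_pow_dvd_of_C_add_X_pow_mul [CharZero K] {c : ℕ} {g : A} (h : IsLefschetz 𝒜 c g)
    (d : ℕ) (i m : ℕ) (him : 2 * i + m = c + d) (u : Polynomial A) (hu : u ∈ polyGrading 𝒜 i)
    (hdvd : Polynomial.X ^ (d + 1) ∣ (Polynomial.C g + Polynomial.X) ^ m * u) :
    Polynomial.X ^ (d + 1) ∣ u := by
  have hcz : ∀ k : ℕ, k ≠ 0 → IsUnit (k : A) := fun k hk => by
    rw [← map_natCast (algebraMap K A)]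
    exact (IsUnit.mk0 _ (Nat.cast_ne_zero.mpr hk)).map _
  induction d generalizing i m u with
  | zero =>
    rw [zero_add, pow_one, Polynomial.X_dvd_iff] at hdvd ⊢
    refine h.injective i m him _ (hu.1 0 i (by omega)) ?_
    simpa [Polynomial.mul_coeff_zero, Polynomial.coeff_zero_eq_eval_zero] using hdvd
  | succ d ih =>
    rcases m with - | m
    · simpa using hdvd
    set G := Polynomial.C g + Polynomial.X with hG
    have hG' : G.derivative = 1 := by simp [hG]
    have hlow : Polynomial.X ^ (d + 1) ∣ G ^ (m + 1) * u :=
      (pow_dvd_pow _ (Nat.le_succ _)).trans hdvd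
    -- the derivative of `G ^ (m + 1) * u` is divisible by one power of `X` less
    have hder : Polynomial.X ^ (d + 1) ∣ G ^ m * u * ((m + 1 : ℕ) : Polynomial A) +
        G ^ (m + 1) * u.derivative := by
      obtain ⟨w, hw⟩ := hdvd
      have := congrArg Polynomial.derivative hw
      rw [Polynomial.derivative_mul, Polynomial.derivative_pow, hG', Polynomial.derivative_mul,
        Polynomial.derivative_X_pow] at this
      simp only [Nat.add_sub_cancel, Polynomial.C_eq_natCast, mul_one] at this
      rw [show G ^ m * u * ((m + 1 : ℕ) : Polynomial A) + G ^ (m + 1) * u.derivative =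
        ((m + 1 : ℕ) : Polynomial A) * G ^ m * u + G ^ (m + 1) * u.derivative by ring, this]
      exact ⟨((d + 1 + 1 : ℕ) : Polynomial A) * w + Polynomial.X * w.derivative, by ring⟩
    have hu' : Polynomial.X ^ (d + 1) ∣ u.derivative := by
      rcases i with - | i
      · have : u.derivative = 0 := by
          ext q
          rw [Polynomial.coeff_derivative, hu.2 _ (by omega), zero_mul, Polynomial.coeff_zero]
        rw [this]
        exact dvd_zero _
      · refine ih i (m + 2) (by omega) _ (derivative_mem_polyGrading hu) ?_
        have h1 := (hder.mul_left G)
        have h2 := hlow.mul_right ((m + 1 : ℕ) : Polynomial A)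
        have := dvd_sub h1 h2
        convert this using 1
        ring
    have hu0 : Polynomial.X ^ (d + 1) ∣ u := by
      refine ih i m (by omega) u hu ?_
      have h1 := (dvd_add_left (hu'.mul_left (G ^ (m + 1)))).mp hder
      refine (IsUnit.dvd_mul_right ?_).mp h1
      simpa using (hcz (m + 1) (by omega)).map (Polynomial.C : A →+* _)
    rw [Polynomial.X_pow_dvd_iff] at hu' hu0 ⊢
    intro q hq
    rcases q with - | q
    · exact hu0 0 (by omega)
    · have := hu' q (by omega)
      rw [Polynomial.coeff_derivative] at this
      have hun := hcz (q + 1) (by omega)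
      push_cast at hun
      exact (hun.mul_left_eq_zero).mp this

end SLP

section Extension

variable {K : Type*} [Field K] {A : Type*} [CommRing A] [Algebra K A]

/-! ### Reduction modulo a homogeneous monic polynomial -/

/-- The polynomials in `A[X]` that are homogeneous of degree `i` and have degree less than `d`
in `X`. -/
def polyGradingLT (𝒜 : ℕ → Submodule K A) (d i : ℕ) : Submodule K (Polynomial A) :=
  polyGrading 𝒜 i ⊓ (Polynomial.degreeLT A d).restrictScalars K

variable {𝒜 : ℕ → Submodule K A}

theorem mem_polyGradingLT {d i : ℕ} {u : Polynomial A} :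
    u ∈ polyGradingLT 𝒜 d i ↔ u ∈ polyGrading 𝒜 i ∧ u.degree < d := by
  rw [polyGradingLT, Submodule.mem_inf, Submodule.restrictScalars_mem, Polynomial.mem_degreeLT]

theorem coeff_eq_zero_of_mem_polyGradingLT {d i q : ℕ} {u : Polynomial A}
    (hu : u ∈ polyGradingLT 𝒜 d i) (hq : d ≤ q) : u.coeff q = 0 :=
  Polynomial.coeff_eq_zero_of_degree_lt
    ((mem_polyGradingLT.mp hu).2.trans_le (by exact_mod_cast hq))

/-- Division with remainder by a homogeneous monic polynomial preserves homogeneity. -/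
theorem exists_mem_polyGradingLT_dvd_sub [SetLike.GradedMonoid 𝒜] {p : Polynomial A}
    (hp : p.Monic) (hpd : p ∈ polyGrading 𝒜 p.natDegree) {i : ℕ} {u : Polynomial A}
    (hu : u ∈ polyGrading 𝒜 i) : ∃ v ∈ polyGradingLT 𝒜 p.natDegree i, p ∣ u - v := by
  obtain ⟨N, hN⟩ : ∃ N : ℕ, u.degree < N := ⟨u.natDegree + 1,
    (Polynomial.degree_le_natDegree).trans_lt (by exact_mod_cast Nat.lt_succ_self _)⟩
  induction N generalizing u with
  | zero =>
    exact ⟨u, mem_polyGradingLT.mpr ⟨hu, hN.trans_le (by simp)⟩, by simp⟩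
  | succ N ih =>
    by_cases hd : N + 1 ≤ p.natDegree
    · exact ⟨u, mem_polyGradingLT.mpr ⟨hu, hN.trans_le (by exact_mod_cast hd)⟩, by simp⟩
    set w := Polynomial.C (u.coeff N) * Polynomial.X ^ (N - p.natDegree) * p with hw
    have hwi : w ∈ polyGrading 𝒜 i := by
      by_cases hNi : N ≤ i
      · have h1 := C_mul_X_pow_mem_polyGrading (hu.1 N (i - N) (by omega))
          (show N - p.natDegree + (i - N) = i - p.natDegree by omega)
        have := SetLike.mul_mem_graded h1 hpd
        rwa [Nat.sub_add_cancel (by omega)] at this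
      · rw [hw, hu.2 N (by omega)]
        simp
    have hlt : (u - w).degree < N := by
      rw [Polynomial.degree_lt_iff_coeff_zero]
      intro m hm
      rw [Polynomial.coeff_sub, hw, mul_assoc, Polynomial.coeff_C_mul,
        Polynomial.coeff_X_pow_mul', if_pos (by omega)]
      rcases hm.eq_or_lt with rfl | hm
      · rw [show N - (N - p.natDegree) = p.natDegree by omega, hp.coeff_natDegree]
        ring
      · rw [(Polynomial.degree_lt_iff_coeff_zero _ _).mp hN m (by omega),
          Polynomial.coeff_eq_zero_of_natDegree_lt (p := p) (by omega)]
        ring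
    obtain ⟨v, hv, hdvd⟩ := ih (sub_mem hu hwi) hlt
    refine ⟨v, hv, ?_⟩
    have := dvd_add hdvd (Dvd.intro_left _ hw.symm : p ∣ w)
    rwa [show u - w - v + w = u - v by ring] at this

instance [FiniteDimensional K A] (d i : ℕ) : FiniteDimensional K (polyGradingLT 𝒜 d i) := by
  let f : polyGradingLT 𝒜 d i →ₗ[K] (Fin d → A) :=
    LinearMap.pi fun q => ((Polynomial.lcoeff A q).restrictScalars K) ∘ₗ Submodule.subtype _
  refine Module.Finite.of_injective f fun u v h => Subtype.ext (Polynomial.ext fun q => ?_)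
  by_cases hq : q < d
  · exact congrFun h ⟨q, hq⟩
  · rw [coeff_eq_zero_of_mem_polyGradingLT u.2 (by omega),
      coeff_eq_zero_of_mem_polyGradingLT v.2 (by omega)]

/-- The space `𝒜 (i - q)`, taken to be `0` for `q > i`. -/
def shiftedPiece (𝒜 : ℕ → Submodule K A) (i q : ℕ) : Submodule K A :=
  if q ≤ i then 𝒜 (i - q) else ⊥

theorem mem_polyGrading_iff {i : ℕ} {u : Polynomial A} :
    u ∈ polyGrading 𝒜 i ↔ ∀ q, u.coeff q ∈ shiftedPiece 𝒜 i q := by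
  constructor
  · intro hu q
    unfold shiftedPiece
    split_ifs with h
    · exact hu.1 q _ (by omega)
    · exact hu.2 q (by omega)
  · intro h
    refine ⟨fun q j hq => ?_, fun q hq => ?_⟩ <;> have := h q <;> unfold shiftedPiece at this
    · rwa [if_pos (by omega), show i - q = j by omega] at this
    · rwa [if_neg (by omega), Submodule.mem_bot] at this

theorem finrank_polyGradingLT [FiniteDimensional K A] (d i : ℕ) :
    Module.finrank K (polyGradingLT 𝒜 d i) =
      ∑ q : Fin d, Module.finrank K (shiftedPiece 𝒜 i q) := by
  let f : polyGradingLT 𝒜 d i →ₗ[K] ((q : Fin d) → shiftedPiece 𝒜 i q) :=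
    LinearMap.pi fun q => (((Polynomial.lcoeff A q).restrictScalars K) ∘ₗ
      Submodule.subtype _).codRestrict _
        fun u => mem_polyGrading_iff.mp (mem_polyGradingLT.mp u.2).1 q
  have hf : ∀ u q, (f u q : A) = (u : Polynomial A).coeff q := fun _ _ => rfl
  have hbij : Function.Bijective f := by
    constructor
    · refine fun u v h => Subtype.ext (Polynomial.ext fun q => ?_)
      by_cases hq : q < d
      · exact congrArg Subtype.val (congrFun h ⟨q, hq⟩)
      · rw [coeff_eq_zero_of_mem_polyGradingLT u.2 (by omega),
          coeff_eq_zero_of_mem_polyGradingLT v.2 (by omega)]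
    · intro v
      set u : Polynomial A :=
        ∑ q : Fin d, Polynomial.C (v q : A) * Polynomial.X ^ (q : ℕ) with hu
      have hc : ∀ k, u.coeff k = if h : k < d then (v ⟨k, h⟩ : A) else 0 := fun k => by
        simp only [hu, Polynomial.finsetSum_coeff, Polynomial.coeff_C_mul_X_pow]
        split_ifs with h
        · rw [Finset.sum_eq_single ⟨k, h⟩]
          · simp
          · exact fun q _ hq => if_neg fun h' => hq (Fin.ext h'.symm)
          · simp
        · exact Finset.sum_eq_zero fun q _ => if_neg (by have := q.2; omega)
      refine ⟨⟨u, mem_polyGradingLT.mpr ⟨mem_polyGrading_iff.mpr fun k => ?_, ?_⟩⟩, ?_⟩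
      · rw [hc]
        split_ifs with h
        · exact (v ⟨k, h⟩).2
        · exact zero_mem _
      · rw [Polynomial.degree_lt_iff_coeff_zero]
        exact fun k hk => by rw [hc, dif_neg (by omega)]
      · funext q
        exact Subtype.ext (by rw [hf]; simp [hc])
  rw [(LinearEquiv.ofBijective f hbij).finrank_eq, Module.finrank_pi_fintype]

/-- The Hilbert function of `A[X] / (p)`, for `p` monic of degree `d + 1`, is symmetric about
`(c + d) / 2`: exchange `X ^ q` and `X ^ (d - q)`. -/
theorem finrank_polyGradingLT_eq [FiniteDimensional K A] {c : ℕ} {g : A}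
    (h : IsLefschetz 𝒜 c g) {d i j : ℕ} (hij : i + j = c + d) :
    Module.finrank K (polyGradingLT 𝒜 (d + 1) i) =
      Module.finrank K (polyGradingLT 𝒜 (d + 1) j) := by
  rw [finrank_polyGradingLT, finrank_polyGradingLT,
    ← Equiv.sum_comp Fin.revPerm fun q : Fin (d + 1) => Module.finrank K (shiftedPiece 𝒜 i q)]
  refine Finset.sum_congr rfl fun q _ => ?_
  have hq := q.2
  have hr : ((Fin.revPerm q : Fin (d + 1)) : ℕ) = d - q := by
    simp [Fin.revPerm_apply, Fin.val_rev]
  rw [hr]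
  unfold shiftedPiece
  by_cases h1 : d - q ≤ i <;> by_cases h2 : (q : ℕ) ≤ j
  · rw [if_pos h1, if_pos h2]
    exact h.finrank_eq _ _ (by omega)
  · rw [if_pos h1, if_neg h2, h.eq_bot (i - (d - q)) (by omega)]
  · rw [if_neg h1, if_pos h2, h.eq_bot (j - q) (by omega)]
  · rw [if_neg h1, if_neg h2]

/-! ### Multiplication by `g + X` modulo a monic polynomial -/

/-- For `p` monic of degree `d` and `v` of degree less than `d`, this is the remainder of
`(g + X) * v` modulo `p`. -/
def mulAddX (g : A) (p : Polynomial A) : Polynomial A →ₗ[K] Polynomial A where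
  toFun v := (Polynomial.C g + Polynomial.X) * v - Polynomial.C (v.coeff (p.natDegree - 1)) * p
  map_add' u v := by simp; ring
  map_smul' a v := by
    rw [Polynomial.coeff_smul, ← Polynomial.smul_C]
    simp [smul_sub, Polynomial.smul_C, ← smul_mul_assoc]

theorem mulAddX_apply (g : A) (p v : Polynomial A) : mulAddX (K := K) g p v =
    (Polynomial.C g + Polynomial.X) * v - Polynomial.C (v.coeff (p.natDegree - 1)) * p := rfl

theorem dvd_sub_mulAddX_pow (g : A) (p v : Polynomial A) (m : ℕ) :
    p ∣ (Polynomial.C g + Polynomial.X) ^ m * v - (mulAddX (K := K) g p ^ m) v := by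
  induction m with
  | zero => simp
  | succ m ih =>
    rw [pow_succ' (mulAddX g p), Module.End.mul_apply]
    set w := (mulAddX (K := K) g p ^ m) v
    rw [mulAddX_apply]
    have h := dvd_add (ih.mul_left (Polynomial.C g + Polynomial.X))
      (dvd_mul_left p (Polynomial.C (w.coeff (p.natDegree - 1))))
    convert h using 1
    ring

theorem degree_mulAddX_pow_lt {g : A} {p : Polynomial A} (hp : p.Monic) (hd : 0 < p.natDegree)
    (m : ℕ) {v : Polynomial A} (hv : v.degree < p.natDegree) :
    ((mulAddX (K := K) g p ^ m) v).degree < p.natDegree := by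
  induction m with
  | zero => simpa using hv
  | succ m ih =>
    rw [pow_succ', Module.End.mul_apply]
    set w := (mulAddX (K := K) g p ^ m) v
    rw [Polynomial.degree_lt_iff_coeff_zero] at ih ⊢
    intro k hk
    rw [mulAddX_apply]
    obtain ⟨k, rfl⟩ : ∃ l, k = l + 1 := ⟨k - 1, by omega⟩
    rw [Polynomial.coeff_sub, add_mul, Polynomial.coeff_add, Polynomial.coeff_C_mul,
      Polynomial.coeff_X_mul, Polynomial.coeff_C_mul, ih _ hk]
    rcases hk.eq_or_lt with hk | hk
    · rw [show p.natDegree - 1 = k by omega, ← hk, hp.coeff_natDegree]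
      ring
    · rw [ih k (by omega), Polynomial.coeff_eq_zero_of_natDegree_lt hk]
      ring

theorem eq_zero_of_monic_dvd {p v : Polynomial A} (hp : p.Monic) (h : p ∣ v)
    (hdeg : v.degree < p.degree) : v = 0 := by
  by_contra hv
  exact hp.not_dvd_of_degree_lt hv hdeg h

theorem mulAddX_pow_eq_zero_iff [Nontrivial A] {g : A} {p : Polynomial A} (hp : p.Monic)
    (hd : 0 < p.natDegree) (m : ℕ) {v : Polynomial A} (hv : v.degree < p.natDegree) :
    (mulAddX (K := K) g p ^ m) v = 0 ↔ p ∣ (Polynomial.C g + Polynomial.X) ^ m * v := by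
  have h := dvd_sub_mulAddX_pow (K := K) g p v m
  constructor
  · intro h0
    rwa [h0, sub_zero] at h
  · intro h1
    refine eq_zero_of_monic_dvd hp ((dvd_sub_right h1).mp h) ?_
    rw [Polynomial.degree_eq_natDegree hp.ne_zero]
    exact degree_mulAddX_pow_lt hp hd m hv

/-- The powers of multiplication by `g + X` modulo `p.scaleRoots ε` depend polynomially on `ε`. -/
theorem mulAddX_scaleRoots_mem_polynomialFamilies (g : A) (p v : Polynomial A) (m : ℕ) :
    (fun ε : K => (mulAddX (K := K) g (p.scaleRoots (algebraMap K A ε)) ^ m) v) ∈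
      polynomialFamilies K (Polynomial A) := by
  induction m with
  | zero => simpa using const_mem_polynomialFamilies v
  | succ m ih =>
    set d := p.natDegree with hd
    have hsum : ∀ ε : K, ∀ a : A, Polynomial.C a * p.scaleRoots (algebraMap K A ε) =
        ∑ k ∈ Finset.range (d + 1),
          ε ^ (d - k) • Polynomial.monomial k (p.coeff k * a) := fun ε a => by
      ext j
      simp only [Polynomial.finsetSum_coeff, Polynomial.coeff_smul, Polynomial.coeff_monomial,
        Polynomial.coeff_C_mul, Polynomial.coeff_scaleRoots, smul_ite, smul_zero,
        Finset.sum_ite_eq', Finset.mem_range]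
      split_ifs with h
      · rw [Algebra.smul_def, map_pow]
        ring
      · rw [Polynomial.coeff_eq_zero_of_natDegree_lt (by omega)]
        ring
    simp only [pow_succ' (mulAddX _ _), Module.End.mul_apply]
    have heq : (fun ε : K => mulAddX (K := K) g (p.scaleRoots (algebraMap K A ε))
        ((mulAddX (K := K) g (p.scaleRoots (algebraMap K A ε)) ^ m) v)) =
        (fun ε : K => LinearMap.mulLeft K (Polynomial.C g + Polynomial.X)
          ((mulAddX (K := K) g (p.scaleRoots (algebraMap K A ε)) ^ m) v)) -
        ∑ k ∈ Finset.range (d + 1), fun ε : K => ε ^ (d - k) •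
          (((Polynomial.monomial k).restrictScalars K ∘ₗ LinearMap.mulLeft K (p.coeff k) ∘ₗ
            (Polynomial.lcoeff A (d - 1)).restrictScalars K)
            ((mulAddX (K := K) g (p.scaleRoots (algebraMap K A ε)) ^ m) v)) := by
      funext ε
      rw [Pi.sub_apply, Finset.sum_apply]
      generalize (mulAddX (K := K) g (p.scaleRoots (algebraMap K A ε)) ^ m) v = w
      rw [mulAddX_apply, hsum, Polynomial.natDegree_scaleRoots]
      rfl
    rw [heq]
    exact sub_mem (map_mem_polynomialFamilies _ ih) (sum_mem fun k _ =>
      pow_smul_mem_polynomialFamilies _ (map_mem_polynomialFamilies _ ih))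

/-! ### The deformation argument -/

theorem scaleRoots_mem_polyGrading {p : Polynomial A} {i : ℕ} (hp : p ∈ polyGrading 𝒜 i) (ε : K) :
    p.scaleRoots (algebraMap K A ε) ∈ polyGrading 𝒜 i := by
  rw [mem_polyGrading_iff] at hp ⊢
  intro q
  rw [Polynomial.coeff_scaleRoots, ← map_pow, mul_comm, ← Algebra.smul_def]
  exact Submodule.smul_mem _ _ (hp q)

theorem IsLefschetz.nontrivial {c : ℕ} {g : A} (h : IsLefschetz 𝒜 c g) : Nontrivial A := by
  by_contra hA
  rw [not_nontrivial_iff_subsingleton] at hA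
  exact h.top_ne_bot (Subsingleton.elim _ _)

/-- The polynomials `p.scaleRoots ε` form a family with value `X ^ (d + 1)` at `ε = 0`, where
`g + X` is a strong Lefschetz element. Hence it is one modulo `p.scaleRoots ε` for some nonzero
`ε`. -/
theorem exists_forall_dvd_of_scaleRoots_dvd [CharZero K] [FiniteDimensional K A]
    [SetLike.GradedMonoid 𝒜] {c : ℕ} {g : A} (h : IsLefschetz 𝒜 c g) {p : Polynomial A}
    (hp : p.Monic) {d : ℕ} (hd : p.natDegree = d + 1) (hpd : p ∈ polyGrading 𝒜 p.natDegree) :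
    ∃ ε : K, ε ≠ 0 ∧ ∀ i m, 2 * i + m = c + d → ∀ u ∈ polyGrading 𝒜 i,
      p.scaleRoots (algebraMap K A ε) ∣ (Polynomial.C g + Polynomial.X) ^ m * u →
      p.scaleRoots (algebraMap K A ε) ∣ u := by
  have := h.nontrivial
  let T : (i m : ℕ) → K → polyGradingLT 𝒜 (d + 1) i →ₗ[K] Polynomial A := fun i m ε =>
    (mulAddX g (p.scaleRoots (algebraMap K A ε)) ^ m) ∘ₗ Submodule.subtype _
  have hT : ∀ i m (ε : K) (v : polyGradingLT 𝒜 (d + 1) i), T i m ε v = 0 ↔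
      p.scaleRoots (algebraMap K A ε) ∣ (Polynomial.C g + Polynomial.X) ^ m * (v : Polynomial A) :=
    fun i m ε v => by
      have hdeg := (mem_polyGradingLT.mp v.2).2
      refine mulAddX_pow_eq_zero_iff (K := K) (g := g) (v := (v : Polynomial A))
        ((Polynomial.monic_scaleRoots_iff _).mpr hp) ?_ m ?_
      · rw [Polynomial.natDegree_scaleRoots]
        omega
      · rwa [Polynomial.natDegree_scaleRoots, hd]
  have hfin : ∀ i m, 2 * i + m = c + d → {ε | ¬ Function.Injective (T i m ε)}.Finite := by
    intro i m him
    refine finite_setOf_not_injective (T i m)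
      (fun v => mulAddX_scaleRoots_mem_polynomialFamilies g p v m) ?_
    rw [injective_iff_map_eq_zero]
    intro v hv
    rw [hT, map_zero, Polynomial.scaleRoots_zero, hp.leadingCoeff, one_smul, hd] at hv
    have hdeg := mem_polyGradingLT.mp v.2
    have := X_pow_dvd_of_C_add_X_pow_mul h d i m him v hdeg.1 hv
    refine Subtype.ext (eq_zero_of_monic_dvd
      (Polynomial.monic_X_pow (d + 1)) this ?_)
    rw [Polynomial.degree_X_pow]
    exact_mod_cast hdeg.2
  -- one `ε` has to serve all degrees at once: finitely many degrees exclude finitely many `ε`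
  obtain ⟨ε, hε⟩ := (((Finset.range (c + d + 1)).finite_toSet.biUnion
    (t := fun i => {ε | 2 * i ≤ c + d ∧ ¬ Function.Injective (T i (c + d - 2 * i) ε)})
    (fun i _ => by
      by_cases hi : 2 * i ≤ c + d
      · exact (hfin i _ (by omega)).subset fun ε h => h.2
      · exact Set.finite_empty.subset fun ε h => hi h.1)).union
    (Set.finite_singleton (0 : K))).infinite_compl.nonempty
  rw [Set.mem_compl_iff, Set.mem_union, not_or] at hε
  refine ⟨ε, hε.2, fun i m him u hu hdvd => ?_⟩
  have hinj : Function.Injective (T i m ε) := by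
    by_contra hn
    refine hε.1 (Set.mem_biUnion (x := i) (by simp; omega) ⟨by omega, ?_⟩)
    rwa [show c + d - 2 * i = m by omega]
  have hpd' := scaleRoots_mem_polyGrading hpd ε
  rw [← Polynomial.natDegree_scaleRoots p (algebraMap K A ε)] at hpd'
  obtain ⟨v, hv, hvd⟩ := exists_mem_polyGradingLT_dvd_sub
    ((Polynomial.monic_scaleRoots_iff _).mpr hp) hpd' hu
  rw [Polynomial.natDegree_scaleRoots, hd] at hv
  have h0 : T i m ε ⟨v, hv⟩ = 0 := by
    rw [hT]
    have := dvd_sub hdvd (hvd.mul_left ((Polynomial.C g + Polynomial.X) ^ m))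
    rwa [← mul_sub, sub_sub_cancel] at this
  have hv0 : v = 0 := congrArg Subtype.val (hinj (h0.trans (map_zero _).symm))
  rwa [hv0, sub_zero] at hvd

theorem scaleRoots_eq_C_mul_comp {ε : K} (hε : ε ≠ 0) (p : Polynomial A) :
    p.scaleRoots (algebraMap K A ε) = Polynomial.C (algebraMap K A (ε ^ p.natDegree)) *
      p.comp (Polynomial.C (algebraMap K A ε⁻¹) * Polynomial.X) := by
  ext k
  rw [Polynomial.coeff_scaleRoots, Polynomial.coeff_C_mul, Polynomial.comp_C_mul_X_coeff]
  by_cases hk : k ≤ p.natDegree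
  · have : ε ^ (p.natDegree - k) = ε ^ p.natDegree * ε⁻¹ ^ k := by
      rw [pow_sub₀ _ hε hk, inv_pow]
    rw [← map_pow, this, map_mul, map_pow _ ε⁻¹]
    ring
  · rw [Polynomial.coeff_eq_zero_of_natDegree_lt (by omega)]
    ring

/-- The substitution `X ↦ ε⁻¹ X` takes `p` to a unit multiple of `p.scaleRoots ε` and
`g + ε X` to `g + X`. -/
theorem exists_forall_dvd_of_dvd [CharZero K] [FiniteDimensional K A]
    [SetLike.GradedMonoid 𝒜] {c : ℕ} {g : A} (h : IsLefschetz 𝒜 c g) {p : Polynomial A}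
    (hp : p.Monic) {d : ℕ} (hd : p.natDegree = d + 1) (hpd : p ∈ polyGrading 𝒜 p.natDegree) :
    ∃ ε : K, ∀ i m, 2 * i + m = c + d → ∀ u ∈ polyGrading 𝒜 i,
      p ∣ (Polynomial.C g + ε • Polynomial.X) ^ m * u → p ∣ u := by
  obtain ⟨ε, hε, H⟩ := exists_forall_dvd_of_scaleRoots_dvd h hp hd hpd
  refine ⟨ε, fun i m him u hu hdvd => ?_⟩
  let τ : K → Polynomial A →+* Polynomial A := fun a =>
    Polynomial.compRingHom (Polynomial.C (algebraMap K A a) * Polynomial.X)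
  have hτ : ∀ a v, τ a v = v.comp (Polynomial.C (algebraMap K A a) * Polynomial.X) :=
    fun _ _ => rfl
  have hunit : IsUnit (Polynomial.C (algebraMap K A (ε ^ p.natDegree))) :=
    ((IsUnit.mk0 _ (pow_ne_zero _ hε)).map (algebraMap K A)).map Polynomial.C
  have hiff : ∀ v, p.scaleRoots (algebraMap K A ε) ∣ v ↔ τ ε⁻¹ p ∣ v := fun v => by
    rw [scaleRoots_eq_C_mul_comp hε, hunit.mul_left_dvd, hτ]
  have hG : τ ε⁻¹ (Polynomial.C g + ε • Polynomial.X) = Polynomial.C g + Polynomial.X := by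
    rw [hτ, Polynomial.add_comp, Polynomial.C_comp, Polynomial.smul_comp, Polynomial.X_comp,
      Algebra.smul_def, Polynomial.algebraMap_apply, ← mul_assoc, ← map_mul, ← map_mul,
      mul_inv_cancel₀ hε, map_one, map_one, one_mul]
  have h1 := (hiff _).mp (H i m him (τ ε⁻¹ u) (comp_C_mul_X_mem_polyGrading hu _) (by
    rw [hiff, ← hG, ← map_pow, ← map_mul]
    exact map_dvd _ hdvd))
  have hinv : ∀ v, τ ε (τ ε⁻¹ v) = v := fun v => by
    ext k
    rw [hτ, hτ, Polynomial.comp_C_mul_X_coeff, Polynomial.comp_C_mul_X_coeff, mul_assoc,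
      ← mul_pow, ← map_mul, inv_mul_cancel₀ hε, map_one, one_pow, mul_one]
  have := map_dvd (τ ε) h1
  rwa [hinv, hinv] at this

/-- If `A` has the strong Lefschetz property with socle degree `c` and `p` is a homogeneous monic
polynomial of degree `d + 1` over `A`, then `B = A[X] / (p)` has the strong Lefschetz property with
socle degree `c + d`. -/
theorem IsLefschetz.exists_of_polynomial [CharZero K] [FiniteDimensional K A]
    [SetLike.GradedMonoid 𝒜] {c : ℕ} {g : A} (h : IsLefschetz 𝒜 c g) {p : Polynomial A}
    (hp : p.Monic) {d : ℕ} (hd : p.natDegree = d + 1) (hpd : p ∈ polyGrading 𝒜 p.natDegree)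
    {B : Type*} [CommRing B] [Algebra K B] (π : Polynomial A →ₐ[K] B)
    (hπ : ∀ u, π u = 0 ↔ p ∣ u) :
    ∃ g', IsLefschetz (fun i => (polyGrading 𝒜 i).map π.toLinearMap) (c + d) g' := by
  have := h.nontrivial
  obtain ⟨ε, H⟩ := exists_forall_dvd_of_dvd h hp hd hpd
  have hmap : ∀ i, (polyGrading 𝒜 i).map π.toLinearMap =
      (polyGradingLT 𝒜 (d + 1) i).map π.toLinearMap := fun i => by
    refine le_antisymm ?_ (Submodule.map_mono inf_le_left)
    rintro _ ⟨u, hu, rfl⟩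
    obtain ⟨v, hv, hdvd⟩ := exists_mem_polyGradingLT_dvd_sub hp hpd hu
    refine ⟨v, hd ▸ hv, ?_⟩
    have := (hπ _).mpr hdvd
    rw [map_sub, sub_eq_zero] at this
    exact this.symm
  have hinj : ∀ i, ∀ v ∈ polyGradingLT 𝒜 (d + 1) i, π v = 0 → v = 0 := fun i v hv h0 => by
    refine eq_zero_of_monic_dvd hp ((hπ v).mp h0) ?_
    rw [Polynomial.degree_eq_natDegree hp.ne_zero, hd]
    exact (mem_polyGradingLT.mp hv).2
  have hrank : ∀ i, Module.finrank K ((polyGrading 𝒜 i).map π.toLinearMap) =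
      Module.finrank K (polyGradingLT 𝒜 (d + 1) i) := fun i => by
    rw [hmap]
    rw [← LinearMap.range_domRestrict]
    refine LinearMap.finrank_range_of_inj ((injective_iff_map_eq_zero _).mpr fun v hv => ?_)
    exact Subtype.ext (hinj i v v.2 hv)
  refine ⟨π (Polynomial.C g + ε • Polynomial.X), ?_, ?_, ?_, ?_, ?_⟩
  · exact ⟨_, C_add_X_mem_polyGrading h.mem ε, rfl⟩
  · obtain ⟨a, ha, ha0⟩ := Submodule.exists_mem_ne_zero_of_ne_bot h.top_ne_bot
    have hmem : Polynomial.C a * Polynomial.X ^ d ∈ polyGradingLT 𝒜 (d + 1) (c + d) :=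
      mem_polyGradingLT.mpr ⟨C_mul_X_pow_mem_polyGrading ha (by omega),
        (Polynomial.degree_C_mul_X_pow_le _ _).trans_lt (by exact_mod_cast Nat.lt_succ_self d)⟩
    rw [hmap]
    intro hbot
    have h0 : π (Polynomial.C a * Polynomial.X ^ d) = 0 := by
      rw [← Submodule.mem_bot K, ← hbot]
      exact ⟨_, hmem, rfl⟩
    have := congrArg (fun v => Polynomial.coeff v d) (hinj _ _ hmem h0)
    simp at this
    exact ha0 this
  · intro i hi
    rw [hmap, Submodule.eq_bot_iff]
    rintro _ ⟨v, hv, rfl⟩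
    have : v = 0 := by
      ext q
      by_cases hq : q < d + 1
      · have hv' := (mem_polyGradingLT.mp hv).1.1 q (i - q) (by omega)
        rw [h.eq_bot _ (by omega)] at hv'
        exact hv'
      · exact coeff_eq_zero_of_mem_polyGradingLT hv (by omega)
    rw [this, map_zero]
  · intro i j hij
    rw [hrank, hrank]
    exact finrank_polyGradingLT_eq h hij
  · rintro i m him _ ⟨u, hu, rfl⟩ h0
    change _ * π u = 0 at h0
    rw [← map_pow, ← map_mul, hπ] at h0
    exact (hπ u).mpr (H i m him u hu h0)

end Extension

/-! ### Transport along surjections with the same kernel -/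

section Transfer

variable {K : Type*} [Field K] {A : Type*} [CommRing A] [Algebra K A]

instance (𝒜 : ℕ → Submodule K A) [SetLike.GradedMonoid 𝒜] (J : Ideal A) :
    SetLike.GradedMonoid (quotientGrading 𝒜 J) where
  one_mem := ⟨1, SetLike.GradedOne.one_mem, map_one (Ideal.Quotient.mkₐ K J)⟩
  mul_mem := by
    rintro i j _ _ ⟨a, ha, rfl⟩ ⟨b, hb, rfl⟩
    exact ⟨a * b, SetLike.GradedMul.mul_mem ha hb, map_mul (Ideal.Quotient.mkₐ K J) a b⟩

variable {B : Type*} [CommRing B] [Algebra K B] {𝒜 : ℕ → Submodule K A}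

theorem IsLefschetz.map {c : ℕ} {g : A} (h : IsLefschetz 𝒜 c g) (e : A ≃ₐ[K] B) :
    IsLefschetz (fun i => (𝒜 i).map e.toLinearMap) c (e g) where
  mem := ⟨g, h.mem, rfl⟩
  top_ne_bot hb := h.top_ne_bot
    (Submodule.map_injective_of_injective e.injective (hb.trans (Submodule.map_bot _).symm))
  eq_bot i hi := by rw [h.eq_bot i hi, Submodule.map_bot]
  finrank_eq i j hij := by
    have := h.finrank_eq i j hij
    rwa [← LinearEquiv.finrank_map_eq e.toLinearEquiv, ← LinearEquiv.finrank_map_eq e.toLinearEquiv]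
      at this
  injective := by
    rintro i m him _ ⟨a, ha, rfl⟩ h0
    change e g ^ m * e a = 0 at h0
    rw [← map_pow, ← map_mul, EmbeddingLike.map_eq_zero_iff] at h0
    change e a = 0
    rw [h.injective i m him a ha h0, map_zero]

variable {Φ : A →ₐ[K] B} {J : Ideal A}

theorem map_quotientGrading_quotientKerAlgEquivOfSurjective (𝒜 : ℕ → Submodule K A)
    (hΦ : Function.Surjective Φ) (i : ℕ) :
    (quotientGrading 𝒜 (RingHom.ker Φ) i).map
      (Ideal.quotientKerAlgEquivOfSurjective hΦ).toLinearMap = (𝒜 i).map Φ.toLinearMap := by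
  rw [quotientGrading, ← Submodule.map_comp]
  rfl

theorem IsLefschetz.map_of_ker_eq {c : ℕ} {g : A ⧸ J} (h : IsLefschetz (quotientGrading 𝒜 J) c g)
    (hΦ : Function.Surjective Φ) (hJ : RingHom.ker Φ = J) :
    ∃ g', IsLefschetz (fun i => (𝒜 i).map Φ.toLinearMap) c g' := by
  subst hJ
  have := h.map (Ideal.quotientKerAlgEquivOfSurjective hΦ)
  simp only [map_quotientGrading_quotientKerAlgEquivOfSurjective] at this
  exact ⟨_, this⟩

theorem IsLefschetz.quotientGrading_of_ker_eq {c : ℕ} {g : B}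
    (h : IsLefschetz (fun i => (𝒜 i).map Φ.toLinearMap) c g)
    (hΦ : Function.Surjective Φ) (hJ : RingHom.ker Φ = J) :
    ∃ g', IsLefschetz (quotientGrading 𝒜 J) c g' := by
  subst hJ
  have := h.map (Ideal.quotientKerAlgEquivOfSurjective hΦ).symm
  simp only [← map_quotientGrading_quotientKerAlgEquivOfSurjective 𝒜 hΦ,
    ← Submodule.map_comp] at this
  have hid : (Ideal.quotientKerAlgEquivOfSurjective hΦ).symm.toLinearMap ∘ₗ
      (Ideal.quotientKerAlgEquivOfSurjective hΦ).toLinearMap = LinearMap.id :=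
    LinearMap.ext fun x => (Ideal.quotientKerAlgEquivOfSurjective hΦ).symm_apply_apply x
  simp only [hid, Submodule.map_id] at this
  exact ⟨_, this⟩

theorem finiteDimensional_quotient_of_ker_eq [FiniteDimensional K B]
    (hΦ : Function.Surjective Φ) (hJ : RingHom.ker Φ = J) : FiniteDimensional K (A ⧸ J) := by
  subst hJ
  exact Module.Finite.equiv (Ideal.quotientKerAlgEquivOfSurjective hΦ).symm.toLinearEquiv

end Transfer

/-! ### Triangular systems -/

section Triangular

variable {K : Type*} [Field K] {n : ℕ}

/-- Systems of homogeneous polynomials of positive degree built up one variable at a time: the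
empty system in no variables is triangular, and a triangular system in `n` variables is extended by
renaming its variables to `x_1, …, x_n` and appending a polynomial in `x_0, …, x_n` that is monic as
a polynomial in `x_0`. Hence the last member of the system involves all the variables, and the first
member only the last variable. -/
inductive IsTriangular : ∀ {n : ℕ}, (Fin n → MvPolynomial (Fin n) K) → Prop
  | nil (F : Fin 0 → MvPolynomial (Fin 0) K) : IsTriangular F
  | snoc {n d : ℕ} {F : Fin n → MvPolynomial (Fin n) K} {p : MvPolynomial (Fin (n + 1)) K}
      (hF : IsTriangular F) (hp : p.IsHomogeneous (d + 1)) (hm : (finSuccEquiv K n p).Monic)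
      (hd : (finSuccEquiv K n p).natDegree = d + 1) :
      IsTriangular (Fin.snoc (α := fun _ => MvPolynomial (Fin (n + 1)) K)
        (fun i => rename Fin.succ (F i)) p)

theorem finSuccEquiv_rename_succ (q : MvPolynomial (Fin n) K) :
    finSuccEquiv K n (rename Fin.succ q) = Polynomial.C q := by
  induction q using MvPolynomial.induction_on with
  | C a => simp [finSuccEquiv_apply]
  | add p q hp hq => simp [hp, hq]
  | mul_X p i hp => rw [map_mul, map_mul, hp, rename_X, finSuccEquiv_X_succ, map_mul]

theorem span_range_snoc {R : Type*} [CommRing R] (F : Fin n → R) (p : R) :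
    Ideal.span (Set.range (Fin.snoc (α := fun _ => R) F p)) =
      Ideal.span (Set.range F) ⊔ Ideal.span {p} := by
  rw [← Ideal.span_union]
  congr 1
  ext x
  simp only [Set.mem_range, Set.mem_union, Set.mem_singleton_iff, Fin.exists_fin_succ']
  simp [eq_comm]

/-- The ideal of an extended triangular system is the kernel of
`R[x_0] → (R / J)[x_0] / (p)`, where `J` is the ideal of the original system. -/
theorem mem_span_range_snoc_iff {F : Fin n → MvPolynomial (Fin n) K}
    {p b : MvPolynomial (Fin (n + 1)) K} :
    b ∈ Ideal.span (Set.range (Fin.snoc (α := fun _ => MvPolynomial (Fin (n + 1)) K)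
        (fun i => rename Fin.succ (F i)) p)) ↔
      (finSuccEquiv K n p).map (Ideal.Quotient.mk (Ideal.span (Set.range F))) ∣
        (finSuccEquiv K n b).map (Ideal.Quotient.mk (Ideal.span (Set.range F))) := by
  set J := Ideal.span (Set.range F) with hJ
  have h1 : (Ideal.span (Set.range (Fin.snoc (α := fun _ => MvPolynomial (Fin (n + 1)) K)
      (fun i => rename Fin.succ (F i)) p))).map (finSuccEquiv K n) =
      J.map Polynomial.C ⊔ Ideal.span {finSuccEquiv K n p} := by
    rw [span_range_snoc, Ideal.map_sup, Ideal.map_span, Ideal.map_span, hJ, Ideal.map_span,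
      Set.image_singleton, ← Set.range_comp, ← Set.range_comp]
    congr 3
    funext i
    exact finSuccEquiv_rename_succ _
  have h2 : b ∈ Ideal.span (Set.range (Fin.snoc (α := fun _ => MvPolynomial (Fin (n + 1)) K)
      (fun i => rename Fin.succ (F i)) p)) ↔
      finSuccEquiv K n b ∈ J.map Polynomial.C ⊔ Ideal.span {finSuccEquiv K n p} := by
    rw [← h1, ← Ideal.mem_comap, Ideal.comap_map_of_bijective _ (finSuccEquiv K n).bijective]
  have hker : J.map Polynomial.C =
      RingHom.ker (Polynomial.mapRingHom (Ideal.Quotient.mk J)) := by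
    rw [Polynomial.ker_mapRingHom, Ideal.mk_ker]
  rw [h2, Submodule.mem_sup]
  constructor
  · rintro ⟨y, hy, z, hz, hyz⟩
    rw [hker, RingHom.mem_ker, Polynomial.coe_mapRingHom] at hy
    rw [← hyz, Polynomial.map_add, hy, zero_add]
    exact Polynomial.map_dvd _ (Ideal.mem_span_singleton.mp hz)
  · rintro ⟨w, hw⟩
    obtain ⟨w, rfl⟩ := Polynomial.map_surjective _ Ideal.Quotient.mk_surjective w
    refine ⟨finSuccEquiv K n b - finSuccEquiv K n p * w, ?_, finSuccEquiv K n p * w,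
      Ideal.mem_span_singleton.mpr (dvd_mul_right _ _), by ring⟩
    rw [hker, RingHom.mem_ker, Polynomial.coe_mapRingHom, Polynomial.map_sub, hw,
      Polynomial.map_mul, sub_self]

theorem map_finSuccEquiv_homogeneousSubmodule (J : Ideal (MvPolynomial (Fin n) K)) (i : ℕ) :
    (homogeneousSubmodule (Fin (n + 1)) K i).map
      ((Polynomial.mapAlgHom (Ideal.Quotient.mkₐ K J)).comp
        (finSuccEquiv K n : _ →ₐ[K] _)).toLinearMap =
      polyGrading (quotientGrading (homogeneousSubmodule (Fin n) K) J) i := by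
  apply le_antisymm
  · rintro _ ⟨φ, hφ, rfl⟩
    have hφ : φ.IsHomogeneous i := hφ
    have hc : ∀ q, (((Polynomial.mapAlgHom (Ideal.Quotient.mkₐ K J)).comp
        (finSuccEquiv K n : _ →ₐ[K] _)).toLinearMap φ).coeff q =
        Ideal.Quotient.mk J ((finSuccEquiv K n φ).coeff q) := fun q =>
      Polynomial.coeff_map _ _
    refine ⟨fun q j hq => ?_, fun q hq => ?_⟩
    · rw [hc]
      exact ⟨_, hφ.finSuccEquiv_coeff_isHomogeneous q j hq, rfl⟩
    · rw [hc, Polynomial.coeff_eq_zero_of_natDegree_lt, map_zero]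
      rw [natDegree_finSuccEquiv]
      exact ((degreeOf_le_totalDegree φ 0).trans hφ.totalDegree_le).trans_lt hq
  · intro u hu
    have hdeg : u.natDegree < i + 1 := Nat.lt_succ_of_le
      (Polynomial.natDegree_le_iff_coeff_eq_zero.mpr hu.2)
    rw [u.as_sum_range' (i + 1) hdeg]
    refine sum_mem fun q hq => ?_
    have hq := Finset.mem_range.mp hq
    obtain ⟨a, ha, hau⟩ := hu.1 q (i - q) (by omega)
    refine ⟨rename Fin.succ a * X 0 ^ q, ?_, ?_⟩
    · have := (IsHomogeneous.rename_isHomogeneous (f := Fin.succ) ha).mul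
        (isHomogeneous_X_pow (R := K) (0 : Fin (n + 1)) q)
      rwa [Nat.sub_add_cancel (by omega)] at this
    · change (finSuccEquiv K n (rename Fin.succ a * X 0 ^ q)).map (Ideal.Quotient.mk J) = _
      rw [map_mul, finSuccEquiv_rename_succ, map_pow, finSuccEquiv_X_zero, Polynomial.map_mul,
        Polynomial.map_C, Polynomial.map_pow, Polynomial.map_X,
        ← Polynomial.C_mul_X_pow_eq_monomial, ← hau]
      rfl

/-- The quotient by a triangular system is a tower of extensions `A[X] / (p)` with `p` monic and
homogeneous, so that `IsLefschetz.exists_of_polynomial` gives the strong Lefschetz property. -/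
theorem IsTriangular.exists_isLefschetz [CharZero K] {F : Fin n → MvPolynomial (Fin n) K}
    (hF : IsTriangular F) :
    FiniteDimensional K (MvPolynomial (Fin n) K ⧸ Ideal.span (Set.range F)) ∧
    ∃ c g, IsLefschetz
      (quotientGrading (homogeneousSubmodule (Fin n) K) (Ideal.span (Set.range F))) c g := by
  induction hF with
  | nil F =>
    have hJ : Ideal.span (Set.range F) = ⊥ := by simp
    have hfin : FiniteDimensional K (MvPolynomial (Fin 0) K) :=
      Module.Finite.equiv (isEmptyAlgEquiv K (Fin 0)).symm.toLinearEquiv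
    rw [hJ]
    refine ⟨Module.Finite.quotient _ _, 0, 0, zero_mem _, ?_, fun i hi => ?_, ?_, ?_⟩
    · intro h
      have h1 : (1 : MvPolynomial (Fin 0) K ⧸ (⊥ : Ideal (MvPolynomial (Fin 0) K))) ∈
          quotientGrading (homogeneousSubmodule (Fin 0) K) ⊥ 0 := SetLike.GradedOne.one_mem
      rw [h, Submodule.mem_bot] at h1
      rw [← map_one (Ideal.Quotient.mk _), Ideal.Quotient.eq_zero_iff_mem] at h1
      exact one_ne_zero h1
    · rw [Submodule.eq_bot_iff]
      rintro _ ⟨φ, hφ, rfl⟩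
      have hφ : φ.IsHomogeneous i := hφ
      have : φ = 0 := by
        ext m
        refine hφ.coeff_eq_zero ?_
        rw [Subsingleton.elim m 0, map_zero]
        exact hi.ne
      rw [this, map_zero]
    · intro i j hij
      rw [show i = j by omega]
    · intro i m him a _ h
      rwa [show m = 0 by omega, pow_zero, one_mul] at h
  | @snoc n d F p hF hp hm hd ih =>
    obtain ⟨hfin, c, g, hg⟩ := ih
    set J := Ideal.span (Set.range F) with hJ
    have := hg.nontrivial
    set P := (finSuccEquiv K n p).map (Ideal.Quotient.mk J) with hP
    have hPm : P.Monic := hm.map _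
    have hPd : P.natDegree = d + 1 := by rw [hP, hm.natDegree_map, hd]
    have hmem : P ∈ polyGrading (quotientGrading (homogeneousSubmodule (Fin n) K) J)
        P.natDegree := by
      rw [hPd, ← map_finSuccEquiv_homogeneousSubmodule]
      exact ⟨p, hp, rfl⟩
    let π : Polynomial (MvPolynomial (Fin n) K ⧸ J) →ₐ[K] AdjoinRoot P :=
      (AdjoinRoot.mkₐ P).restrictScalars K
    obtain ⟨g', hg'⟩ := hg.exists_of_polynomial hPm hPd hmem π
      (fun u => AdjoinRoot.mk_eq_zero)
    let ψ := (Polynomial.mapAlgHom (Ideal.Quotient.mkₐ K J)).comp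
        (finSuccEquiv K n : MvPolynomial (Fin (n + 1)) K →ₐ[K] _)
    have hΦ : Function.Surjective (π.comp ψ) := by
      refine AdjoinRoot.mk_surjective.comp ?_
      exact (Polynomial.map_surjective _ Ideal.Quotient.mk_surjective).comp
        (finSuccEquiv K n).surjective
    have hker : RingHom.ker (π.comp ψ) = Ideal.span (Set.range
        (Fin.snoc (α := fun _ => MvPolynomial (Fin (n + 1)) K)
          (fun i => rename Fin.succ (F i)) p)) := by
      ext b
      rw [mem_span_range_snoc_iff, RingHom.mem_ker]
      exact AdjoinRoot.mk_eq_zero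
    have hfin' : FiniteDimensional K (AdjoinRoot P) := by
      have := hPm.finite_adjoinRoot
      exact Module.Finite.trans (MvPolynomial (Fin n) K ⧸ J) _
    refine ⟨finiteDimensional_quotient_of_ker_eq hΦ hker, c + d, ?_⟩
    refine IsLefschetz.quotientGrading_of_ker_eq (g := g') ?_ hΦ hker
    convert hg' using 2 with i
    rw [← map_finSuccEquiv_homogeneousSubmodule, ← Submodule.map_comp]
    rfl

theorem IsTriangular.exists_isHomogeneous {F : Fin n → MvPolynomial (Fin n) K}
    (hF : IsTriangular F) (i : Fin n) : ∃ d, 0 < d ∧ (F i).IsHomogeneous d := by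
  induction hF with
  | nil F => exact i.elim0
  | @snoc n d F p hF hp hm hd ih =>
    refine Fin.lastCases ?_ (fun j => ?_) i
    · exact ⟨d + 1, d.succ_pos, by simpa using hp⟩
    · obtain ⟨e, he, h⟩ := ih j
      exact ⟨e, he, by simpa using h.rename_isHomogeneous⟩

theorem isSMulRegular_quotient_of_monic {S : Type*} [CommRing S] (J : Ideal S) {P : Polynomial S}
    (hP : P.Monic) : IsSMulRegular (Polynomial S ⧸ J.map Polynomial.C) P := by
  have hker : J.map Polynomial.C =
      RingHom.ker (Polynomial.mapRingHom (Ideal.Quotient.mk J)) := by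
    rw [Polynomial.ker_mapRingHom, Ideal.mk_ker]
  rw [isSMulRegular_iff_right_eq_zero_of_smul]
  intro x hx
  obtain ⟨q, rfl⟩ := Ideal.Quotient.mk_surjective x
  rw [← Ideal.Quotient.mk_eq_mk, ← Submodule.Quotient.mk_smul, smul_eq_mul,
    Submodule.Quotient.mk_eq_zero, hker, RingHom.mem_ker, map_mul] at hx
  rw [Ideal.Quotient.eq_zero_iff_mem, hker, RingHom.mem_ker]
  exact ((hP.map (Ideal.Quotient.mk J)).mul_right_eq_zero_iff).mp hx

open RingTheory.Sequence in
theorem IsTriangular.isWeaklyRegular {F : Fin n → MvPolynomial (Fin n) K} (hF : IsTriangular F) :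
    IsWeaklyRegular (MvPolynomial (Fin n) K) (List.ofFn F) := by
  induction hF with
  | nil F => simp
  | @snoc n d F p hF hp hm hd ih =>
    set bs : List (Polynomial (MvPolynomial (Fin n) K)) :=
      (List.ofFn F).map Polynomial.C ++ [finSuccEquiv K n p] with hbs
    have hmap : (List.ofFn (Fin.snoc (α := fun _ => MvPolynomial (Fin (n + 1)) K)
        (fun i => rename Fin.succ (F i)) p)).map (finSuccEquiv K n) = bs := by
      rw [List.ofFn_succ']
      simp only [Fin.snoc_castSucc, Fin.snoc_last, List.concat_eq_append, List.map_append,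
        List.map_ofFn, hbs, List.map_cons, List.map_nil]
      congr 2
      funext i
      exact finSuccEquiv_rename_succ _
    rw [AddEquiv.isWeaklyRegular_congr (e := (finSuccEquiv K n).toAddEquiv) (bs := bs) (by
      rw [← hmap, List.forall₂_map_right_iff, List.forall₂_same]
      exact fun r _ x => map_mul (finSuccEquiv K n) r x)]
    rw [hbs, isWeaklyRegular_append_iff]
    refine ⟨ih.of_flat, ?_⟩
    rw [isWeaklyRegular_singleton_iff, smul_eq_mul, Ideal.mul_top, ← Ideal.map_ofList]
    exact isSMulRegular_quotient_of_monic _ hm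

theorem IsTriangular.isCompleteIntersection {F : Fin n → MvPolynomial (Fin n) K}
    (hF : IsTriangular F) : IsCompleteIntersection (Ideal.span (Set.range F)) := by
  refine ⟨F, hF.exists_isHomogeneous, ⟨hF.isWeaklyRegular, ?_⟩, rfl⟩
  intro h
  rw [smul_eq_mul, Ideal.mul_top] at h
  have hle : Ideal.ofList (List.ofFn F) ≤ RingHom.ker (constantCoeff (R := K) (σ := Fin n)) := by
    rw [Ideal.ofList, Ideal.span_le]
    intro f hf
    obtain ⟨i, rfl⟩ := (List.mem_ofFn' F f).mp hf
    obtain ⟨d, hd, hi⟩ := hF.exists_isHomogeneous i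
    exact hi.coeff_eq_zero (by simpa using hd.ne)
  rw [← h] at hle
  have := hle (Submodule.mem_top (x := 1))
  simp at this

end Triangular

/-! ### Complete homogeneous symmetric functions -/

section Symmetric

section CompleteHomogeneous

variable {S : Type*} [CommRing S]

/-- The generating series `∏ i, (1 - y i * T)⁻¹`, whose coefficients are the complete homogeneous
symmetric functions of the `y i`. -/
def hSeries {m : ℕ} (y : Fin m → S) : PowerSeries S :=
  ∏ i, PowerSeries.mk fun k => y i ^ k

/-- The generating series `∏ i, (1 - y i * T)`, whose coefficients are, up to sign, the elementary
symmetric functions of the `y i`. -/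
def eSeries {m : ℕ} (y : Fin m → S) : PowerSeries S :=
  ∏ i, (1 - PowerSeries.C (y i) * PowerSeries.X)

theorem eSeries_mul_hSeries {m : ℕ} (y : Fin m → S) : eSeries y * hSeries y = 1 := by
  rw [eSeries, hSeries, ← Finset.prod_mul_distrib]
  refine Finset.prod_eq_one fun i _ => ?_
  ext k
  rw [sub_mul, one_mul, mul_assoc, map_sub, PowerSeries.coeff_C_mul, PowerSeries.coeff_mk,
    PowerSeries.coeff_one]
  rcases k with - | k
  · simp
  · rw [PowerSeries.coeff_succ_X_mul, PowerSeries.coeff_mk, if_neg (Nat.succ_ne_zero k)]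
    ring

theorem coeff_hSeries_succ {m : ℕ} (y : Fin (m + 1) → S) (a : ℕ) :
    PowerSeries.coeff a (hSeries y) = ∑ k ∈ Finset.range (a + 1),
      y 0 ^ k * PowerSeries.coeff (a - k) (hSeries fun i => y i.succ) := by
  rw [hSeries, Fin.prod_univ_succ, PowerSeries.coeff_mul,
    Finset.Nat.sum_antidiagonal_eq_sum_range_succ_mk]
  simp only [PowerSeries.coeff_mk]
  rfl

theorem coeff_hSeries_one (y : Fin 1 → S) (a : ℕ) :
    PowerSeries.coeff a (hSeries y) = y 0 ^ a := by
  simp [hSeries]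

theorem coeff_zero_hSeries {m : ℕ} (y : Fin m → S) : PowerSeries.coeff 0 (hSeries y) = 1 := by
  rw [PowerSeries.coeff_zero_eq_constantCoeff_apply, hSeries, map_prod]
  refine Finset.prod_eq_one fun i _ => ?_
  rw [← PowerSeries.coeff_zero_eq_constantCoeff_apply, PowerSeries.coeff_mk, pow_zero]

theorem map_coeff_hSeries {S' : Type*} [CommRing S'] (f : S →+* S') {m : ℕ} (y : Fin m → S)
    (a : ℕ) : f (PowerSeries.coeff a (hSeries y)) =
      PowerSeries.coeff a (hSeries fun i => f (y i)) := by
  rw [← PowerSeries.coeff_map, hSeries, hSeries, map_prod]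
  congr 2
  funext i
  ext k
  simp

/-- With `y i = x i ^ r`, the system consisting of `x_m ^ t` followed by the complete homogeneous
symmetric functions `h_{a+m}(y_{m-1}, y_m)`, …, `h_{a+2}(y_1, …, y_m)`, `h_{a+1}(y_0, …, y_m)`.
The shift `a` makes the recursion on the number of variables possible. -/
def triangularSystem (r t : ℕ) : {m : ℕ} → ℕ → (Fin (m + 1) → S) → Fin (m + 1) → S
  | 0, _, x => fun _ => x 0 ^ t
  | m + 1, a, x => Fin.snoc (α := fun _ => S)
      (triangularSystem r t (a + 1) fun i : Fin (m + 1) => x i.succ)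
      (PowerSeries.coeff (a + 1) (hSeries fun i => x i ^ r))

theorem map_triangularSystem {S' : Type*} [CommRing S'] (f : S →+* S') (r t : ℕ) {m : ℕ} (a : ℕ)
    (x : Fin (m + 1) → S) (i : Fin (m + 1)) : f (triangularSystem r t a x i) =
      triangularSystem r t a (fun i => f (x i)) i := by
  induction m generalizing a with
  | zero => simp [triangularSystem]
  | succ m ih =>
    refine Fin.lastCases ?_ (fun j => ?_) i
    · simp [triangularSystem, map_coeff_hSeries]
    · simp [triangularSystem, ih]

/-- When `f * hSeries y` has no term of degree `a + 1`, the coefficients of degree `a + 1` of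
`hSeries y` and of `f` agree up to sign modulo the coefficients of `f` of degree `1, …, a`. -/
theorem coeff_hSeries_add_coeff_mem {m : ℕ} (y : Fin m → S) (f : PowerSeries S)
    (hf : PowerSeries.coeff 0 f = 1) (a : ℕ)
    (hq : PowerSeries.coeff (a + 1) (f * hSeries y) = 0) :
    PowerSeries.coeff (a + 1) (hSeries y) + PowerSeries.coeff (a + 1) f ∈
      Ideal.span ((fun i => PowerSeries.coeff i f) '' Set.Icc 1 a) := by
  rw [PowerSeries.coeff_mul, Finset.Nat.sum_antidiagonal_eq_sum_range_succ_mk,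
    Finset.sum_range_succ, Finset.sum_range_succ', Nat.sub_self, coeff_zero_hSeries, mul_one,
    hf, one_mul, Nat.sub_zero, add_assoc] at hq
  rw [eq_neg_of_add_eq_zero_right hq, neg_mem_iff]
  refine sum_mem fun i hi => Ideal.mul_mem_right _ _ (Ideal.subset_span ⟨i + 1, ?_, rfl⟩)
  have := Finset.mem_range.mp hi
  exact ⟨by omega, by omega⟩

theorem sup_span_singleton_eq_of_sub_mul_mem (J : Ideal S) {a b u : S} (hu : IsUnit u)
    (h : a - u * b ∈ J) : J ⊔ Ideal.span {a} = J ⊔ Ideal.span {b} := by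
  rw [← Ideal.span_singleton_mul_left_unit hu b]
  apply le_antisymm <;> refine sup_le le_sup_left ((Ideal.span_singleton_le_iff_mem _).mpr ?_)
  · have := add_mem (Ideal.mem_sup_left h) (Ideal.mem_sup_right
      (Ideal.mem_span_singleton_self (u * b)))
    rwa [sub_add_cancel] at this
  · have := sub_mem (Ideal.mem_sup_right (Ideal.mem_span_singleton_self a))
      (Ideal.mem_sup_left h)
    rwa [sub_sub_cancel] at this

theorem sup_span_coeff_hSeries {m : ℕ} (y : Fin m → S) (f : PowerSeries S)
    (hf : PowerSeries.coeff 0 f = 1) (a : ℕ)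
    (hq : PowerSeries.coeff (a + 1) (f * hSeries y) = 0) :
    Ideal.span ((fun i => PowerSeries.coeff i f) '' Set.Icc 1 a) ⊔
        Ideal.span {PowerSeries.coeff (a + 1) (hSeries y)} =
      Ideal.span ((fun i => PowerSeries.coeff i f) '' Set.Icc 1 (a + 1)) := by
  rw [show Set.Icc 1 (a + 1) = Set.Icc 1 a ∪ {a + 1} by
      ext x
      simp
      omega,
    Set.image_union, Ideal.span_union, Set.image_singleton]
  refine sup_span_singleton_eq_of_sub_mul_mem _ isUnit_one.neg ?_
  rw [neg_one_mul, sub_neg_eq_add]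
  exact coeff_hSeries_add_coeff_mem y f hf a hq

theorem coeff_zero_eSeries {m : ℕ} (y : Fin m → S) : PowerSeries.coeff 0 (eSeries y) = 1 := by
  simp [eSeries, PowerSeries.coeff_zero_eq_constantCoeff_apply, map_prod]

/-- Here `q` accounts for the factors `1 - y * T` of variables that have already been split off, so
that `q * eSeries` is the generating series of the elementary symmetric functions in all of the
variables; multiplying it by `hSeries` of the remaining variables leaves `q`, which has degree at
most `a`. -/
theorem span_range_triangularSystem_aux (r t : ℕ) {m : ℕ} (a : ℕ) (x : Fin (m + 1) → S)
    (q : Polynomial S) (hq : q.natDegree ≤ a) (hq0 : q.coeff 0 = 1) :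
    Ideal.span ((fun i => PowerSeries.coeff i ((q : PowerSeries S) * eSeries fun i => x i ^ r)) ''
        Set.Icc 1 a) ⊔ Ideal.span (Set.range (triangularSystem r t a x)) =
      Ideal.span ((fun i => PowerSeries.coeff i ((q : PowerSeries S) * eSeries fun i => x i ^ r)) ''
        Set.Icc 1 (a + m)) ⊔ Ideal.span {x (Fin.last m) ^ t} := by
  induction m generalizing a q with
  | zero =>
    rw [add_zero]
    congr 2
    ext z
    simp [triangularSystem]
  | succ m ih =>
    set f : PowerSeries S := (q : PowerSeries S) * eSeries fun i => x i ^ r with hf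
    set q' : Polynomial S := q * (1 - Polynomial.C (x 0 ^ r) * Polynomial.X) with hq'
    have hff : f = (q' : PowerSeries S) * eSeries fun i : Fin (m + 1) => x i.succ ^ r := by
      rw [hf, eSeries, Fin.prod_univ_succ, hq', Polynomial.coe_mul, Polynomial.coe_sub,
        Polynomial.coe_mul, Polynomial.coe_one, Polynomial.coe_C, Polynomial.coe_X, mul_assoc]
      rfl
    have hq'd : q'.natDegree ≤ a + 1 := by
      refine Polynomial.natDegree_mul_le.trans (add_le_add hq ?_)
      refine (Polynomial.natDegree_sub_le _ _).trans (max_le (by simp) ?_)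
      exact Polynomial.natDegree_C_mul_X_pow_le (x 0 ^ r) 1 |>.trans' (by simp)
    have hq'0 : q'.coeff 0 = 1 := by
      simp [hq', Polynomial.mul_coeff_zero, hq0]
    have h := ih (a + 1) (fun i => x i.succ) q' hq'd hq'0
    rw [← hff] at h
    rw [show a + (m + 1) = a + 1 + m by omega]
    rw [show x (Fin.last (m + 1)) = x (Fin.last m).succ from rfl]
    rw [← h]
    have hf0 : PowerSeries.coeff 0 f = 1 := by
      have h1 := coeff_zero_eSeries fun i => x i ^ r
      have h2 : PowerSeries.coeff 0 (q : PowerSeries S) = 1 := by rw [Polynomial.coeff_coe, hq0]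
      rw [PowerSeries.coeff_zero_eq_constantCoeff_apply] at h1 h2 ⊢
      rw [hf, map_mul, h1, h2, one_mul]
    rw [triangularSystem, span_range_snoc, sup_left_comm, sup_comm,
      ← sup_span_coeff_hSeries (fun i => x i ^ r) f hf0 a]
    rw [hf, mul_assoc, eSeries_mul_hSeries, mul_one, Polynomial.coeff_coe]
    exact Polynomial.coeff_eq_zero_of_natDegree_lt (by omega)

/-- The complete homogeneous functions in the system for `a = 0` generate the same ideal as the
elementary symmetric functions `e_1, …, e_m` of all `m + 1` variables `x i ^ r`. -/
theorem span_range_triangularSystem (r t : ℕ) {m : ℕ} (x : Fin (m + 1) → S) :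
    Ideal.span (Set.range (triangularSystem r t 0 x)) =
      Ideal.span ((fun i => PowerSeries.coeff i (eSeries fun i => x i ^ r)) ''
        Set.Icc 1 m) ⊔ Ideal.span {x (Fin.last m) ^ t} := by
  have := span_range_triangularSystem_aux r t 0 x 1 (by simp) (by simp)
  simpa using this

/-- Modulo `e_1, …, e_m`, the polynomial `∏ i, (T - y i)` becomes `T ^ (m + 1) ± e_{m+1}`, and
`y_m` is a root. -/
theorem pow_add_coeff_eSeries_mem {m : ℕ} (y : Fin (m + 1) → S) :
    y (Fin.last m) ^ (m + 1) + PowerSeries.coeff (m + 1) (eSeries y) ∈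
      Ideal.span ((fun i => PowerSeries.coeff i (eSeries y)) '' Set.Icc 1 m) := by
  have h := coeff_hSeries_add_coeff_mem (fun _ : Fin 1 => y (Fin.last m)) (eSeries y)
    (coeff_zero_eSeries y) m ?_
  · rwa [coeff_hSeries_one] at h
  set q : Polynomial S := ∏ i : Fin m, (1 - Polynomial.C (y i.castSucc) * Polynomial.X) with hq
  have hqd : q.natDegree ≤ m := by
    refine (Polynomial.natDegree_prod_le _ _).trans ?_
    refine (Finset.sum_le_card_nsmul _ _ 1 fun i _ => ?_).trans (by simp)
    refine (Polynomial.natDegree_sub_le _ _).trans (max_le (by simp) ?_)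
    exact Polynomial.natDegree_C_mul_X_pow_le (y i.castSucc) 1 |>.trans' (by simp)
  have h1 : eSeries y * hSeries (fun _ : Fin 1 => y (Fin.last m)) = (q : PowerSeries S) := by
    have h2 := eSeries_mul_hSeries (fun _ : Fin 1 => y (Fin.last m))
    have h3 : eSeries y = (q : PowerSeries S) * eSeries (fun _ : Fin 1 => y (Fin.last m)) := by
      rw [eSeries, Fin.prod_univ_castSucc, hq, ← Polynomial.coeToPowerSeries.ringHom_apply,
        map_prod, eSeries, Fin.prod_univ_one]
      simp
    rw [h3, mul_assoc, h2, mul_one]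
  rw [h1, Polynomial.coeff_coe]
  exact Polynomial.coeff_eq_zero_of_natDegree_lt (by omega)

end CompleteHomogeneous

/-! ### The ideal of the elementary symmetric polynomials -/

variable {K : Type*} [Field K]

theorem coeff_eSeries_X_pow (n r d : ℕ) :
    PowerSeries.coeff d (eSeries fun i : Fin n => (X i : MvPolynomial (Fin n) K) ^ r) =
      (-1) ^ d * esymmPow K n r d := by
  have h : ∀ t : Finset (Fin n), ∏ i ∈ t, (-(PowerSeries.C ((X i : MvPolynomial (Fin n) K) ^ r) *
      PowerSeries.X)) = PowerSeries.C ((-1) ^ t.card * ∏ i ∈ t, (X i) ^ r) *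
        PowerSeries.X ^ t.card := fun t => by
    rw [Finset.prod_neg, Finset.prod_mul_distrib, Finset.prod_const, map_mul, map_prod]
    simp [mul_assoc]
  simp only [eSeries, sub_eq_add_neg, Finset.prod_one_add, h, map_sum, PowerSeries.coeff_C_mul,
    PowerSeries.coeff_X_pow]
  rw [esymmPow, esymm, map_sum, Finset.mul_sum, Finset.powersetCard_eq_filter, Finset.sum_filter]
  refine Finset.sum_congr rfl fun t _ => ?_
  simp only [map_prod, aeval_X, eq_comm (a := d)]
  split_ifs with ht
  · rw [ht, mul_one]
  · rw [mul_zero]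

theorem esymmPow_self_pow (n r q : ℕ) : esymmPow K n (r * q) n = esymmPow K n r n ^ q := by
  have h : ∀ t, esymmPow K n t n = ∏ i, (X i) ^ t := fun t => by
    rw [esymmPow, esymm]
    have : Finset.powersetCard n (Finset.univ : Finset (Fin n)) = {Finset.univ} := by
      simpa using Finset.powersetCard_self (Finset.univ : Finset (Fin n))
    simp [this]
  rw [h, h, ← Finset.prod_pow]
  simp only [pow_mul]

/-- Modulo the other generators, `e_n(x_1^s, …, x_n^s) = e_n(x_1^r, …, x_n^r) ^ (s / r)` is
`± x_n ^ (s n)`. -/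
theorem symmIdeal_eq_span_range_triangularSystem (m r s : ℕ) (hrs : r ∣ s) :
    symmIdeal K (m + 1) r s =
      Ideal.span (Set.range (triangularSystem r (s * (m + 1)) 0 (X : Fin (m + 1) → _))) := by
  obtain ⟨q, rfl⟩ := hrs
  set E := eSeries fun i : Fin (m + 1) => (X i : MvPolynomial (Fin (m + 1)) K) ^ r with hE
  have hunit : ∀ d : ℕ, IsUnit ((-1 : MvPolynomial (Fin (m + 1)) K) ^ d) :=
    fun d => isUnit_one.neg.pow d
  have hJ : Ideal.span {f | ∃ d, 1 ≤ d ∧ d < m + 1 ∧ f = esymmPow K (m + 1) r d} =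
      Ideal.span ((fun i => PowerSeries.coeff i E) '' Set.Icc 1 m) := by
    apply le_antisymm <;> rw [Ideal.span_le]
    · rintro _ ⟨d, h1, h2, rfl⟩
      rw [SetLike.mem_coe, ← Ideal.unit_mul_mem_iff_mem _ (hunit d), ← coeff_eSeries_X_pow]
      exact Ideal.subset_span ⟨d, ⟨h1, by omega⟩, rfl⟩
    · rintro _ ⟨d, ⟨h1, h2⟩, rfl⟩
      dsimp only
      rw [hE, coeff_eSeries_X_pow]
      exact Ideal.mul_mem_left _ _ (Ideal.subset_span ⟨d, h1, by omega, rfl⟩)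
  rw [symmIdeal, Ideal.span_union, hJ, span_range_triangularSystem]
  refine sup_span_singleton_eq_of_sub_mul_mem (u := ((-1) ^ m) ^ q) _ ((hunit m).pow q) ?_
  rw [esymmPow_self_pow, show r * q * (m + 1) = r * (m + 1) * q by ring,
    pow_mul _ (r * (m + 1)) q, ← mul_pow]
  refine Ideal.mem_of_dvd _ (sub_dvd_pow_sub_pow _ _ q) ?_
  rw [← Ideal.unit_mul_mem_iff_mem _ (hunit (m + 1)), mul_sub, ← coeff_eSeries_X_pow,
    ← mul_assoc, ← pow_add, show m + 1 + m = 2 * m + 1 by ring, pow_succ, pow_mul,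
    neg_one_sq, one_pow, one_mul, neg_one_mul, sub_neg_eq_add,
    add_comm (PowerSeries.coeff _ _)]
  have := pow_add_coeff_eSeries_mem
    fun i : Fin (m + 1) => (X i : MvPolynomial (Fin (m + 1)) K) ^ r
  rwa [← pow_mul] at this

/-! ### Triangularity of the complete homogeneous system -/

theorem rename_succ_coeff_hSeries_X_pow (n r a : ℕ) :
    rename Fin.succ (PowerSeries.coeff a
      (hSeries fun i : Fin n => (X i : MvPolynomial (Fin n) K) ^ r)) =
    PowerSeries.coeff a
      (hSeries fun i : Fin n => (X i.succ : MvPolynomial (Fin (n + 1)) K) ^ r) := by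
  have h := map_coeff_hSeries (rename Fin.succ : MvPolynomial (Fin n) K →ₐ[K] _).toRingHom
    (fun i => X i ^ r) a
  simpa only [AlgHom.toRingHom_eq_coe, RingHom.coe_coe, map_pow, rename_X] using h

theorem isHomogeneous_coeff_hSeries_X_pow (n r a : ℕ) :
    (PowerSeries.coeff a
      (hSeries fun i : Fin n => (X i : MvPolynomial (Fin n) K) ^ r)).IsHomogeneous (r * a) := by
  induction n generalizing a with
  | zero =>
    rw [hSeries, Finset.univ_eq_empty, Finset.prod_empty, PowerSeries.coeff_one]
    split_ifs with h
    · rw [h]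
      exact isHomogeneous_one _ _
    · exact isHomogeneous_zero _ _ _
  | succ n ih =>
    rw [coeff_hSeries_succ]
    refine IsHomogeneous.sum _ _ _ fun k hk => ?_
    have hk := Finset.mem_range.mp hk
    have h1 := (ih (a - k)).rename_isHomogeneous (f := Fin.succ)
    rw [rename_succ_coeff_hSeries_X_pow] at h1
    rw [← pow_mul]
    have := (isHomogeneous_X_pow (R := K) (0 : Fin (n + 1)) (r * k)).mul h1
    rwa [← mul_add, Nat.add_sub_cancel' (by omega)] at this

/-- The expansion of `h_a(x_0^r, …, x_n^r)` in powers of `x_0`; for `r ≥ 1` it shows that this is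
monic of degree `r * a` in `x_0`. -/
theorem finSuccEquiv_coeff_hSeries_X_pow (n r a : ℕ) :
    finSuccEquiv K n (PowerSeries.coeff a
        (hSeries fun i : Fin (n + 1) => (X i : MvPolynomial (Fin (n + 1)) K) ^ r)) =
      Polynomial.X ^ (r * a) + ∑ k ∈ Finset.range a,
        Polynomial.C (PowerSeries.coeff (a - k)
          (hSeries fun i : Fin n => (X i : MvPolynomial (Fin n) K) ^ r)) *
            Polynomial.X ^ (r * k) := by
  rw [coeff_hSeries_succ, Finset.sum_range_succ, Nat.sub_self, coeff_zero_hSeries, mul_one,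
    map_add, map_pow, map_pow, finSuccEquiv_X_zero, ← pow_mul, add_comm, map_sum]
  congr 1
  refine Finset.sum_congr rfl fun k _ => ?_
  rw [← rename_succ_coeff_hSeries_X_pow, map_mul, finSuccEquiv_rename_succ, map_pow, map_pow,
    finSuccEquiv_X_zero, ← pow_mul, mul_comm]

theorem degree_sum_C_mul_X_pow_lt {S : Type*} [CommRing S] {r : ℕ} (hr : 1 ≤ r) (a : ℕ)
    (f : ℕ → S) : (∑ k ∈ Finset.range a, Polynomial.C (f k) * Polynomial.X ^ (r * k)).degree <
      ((r * a : ℕ) : WithBot ℕ) := by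
  rw [← Polynomial.mem_degreeLT]
  refine sum_mem fun k hk => ?_
  rw [Polynomial.mem_degreeLT]
  refine (Polynomial.degree_C_mul_X_pow_le _ _).trans_lt ?_
  exact_mod_cast Nat.mul_lt_mul_of_pos_left (Finset.mem_range.mp hk) hr

theorem triangularSystem_X_succ (r t a : ℕ) (m : ℕ) :
    triangularSystem r t a (fun i : Fin (m + 1) => (X i.succ : MvPolynomial (Fin (m + 2)) K)) =
      fun i => rename Fin.succ (triangularSystem r t a X i) := by
  funext i
  have := map_triangularSystem (rename Fin.succ : MvPolynomial (Fin (m + 1)) K →ₐ[K] _).toRingHom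
    r t a X i
  simp only [AlgHom.toRingHom_eq_coe, RingHom.coe_coe, rename_X] at this
  exact this.symm

theorem triangularSystem_zero_X (r t a : ℕ) :
    triangularSystem r t a (X : Fin 1 → MvPolynomial (Fin 1) K) =
      Fin.snoc (α := fun _ => MvPolynomial (Fin 1) K) (fun i => rename Fin.succ
        ((0 : Fin 0 → MvPolynomial (Fin 0) K) i)) (X 0 ^ t) := by
  funext i
  obtain rfl : i = Fin.last 0 := Subsingleton.elim (α := Fin 1) _ _
  rw [Fin.snoc_last]
  rfl

theorem monic_finSuccEquiv_coeff_hSeries {r : ℕ} (hr : 1 ≤ r) (n a : ℕ) :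
    (finSuccEquiv K n (PowerSeries.coeff a
      (hSeries fun i : Fin (n + 1) => (X i : MvPolynomial (Fin (n + 1)) K) ^ r))).Monic := by
  rw [finSuccEquiv_coeff_hSeries_X_pow]
  exact Polynomial.monic_X_pow_add (degree_sum_C_mul_X_pow_lt hr a _)

theorem natDegree_finSuccEquiv_coeff_hSeries {r : ℕ} (hr : 1 ≤ r) (n a : ℕ) :
    (finSuccEquiv K n (PowerSeries.coeff a
      (hSeries fun i : Fin (n + 1) => (X i : MvPolynomial (Fin (n + 1)) K) ^ r))).natDegree =
      r * a := by
  rw [finSuccEquiv_coeff_hSeries_X_pow]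
  refine Polynomial.natDegree_eq_of_degree_eq_some ?_
  have hlt := degree_sum_C_mul_X_pow_lt hr a fun k => PowerSeries.coeff (a - k)
    (hSeries fun i : Fin n => (X i : MvPolynomial (Fin n) K) ^ r)
  rw [Polynomial.degree_add_eq_left_of_degree_lt (by rwa [Polynomial.degree_X_pow]),
    Polynomial.degree_X_pow]

theorem isTriangular_triangularSystem (r t : ℕ) (hr : 1 ≤ r) (ht : 1 ≤ t) (m a : ℕ) :
    IsTriangular (triangularSystem r t a (X : Fin (m + 1) → MvPolynomial (Fin (m + 1)) K)) := by
  induction m generalizing a with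
  | zero =>
    obtain ⟨t, rfl⟩ : ∃ u, t = u + 1 := ⟨t - 1, by omega⟩
    rw [triangularSystem_zero_X]
    refine .snoc (.nil _) (isHomogeneous_X_pow _ _) ?_ ?_ <;>
      rw [map_pow, finSuccEquiv_X_zero]
    · exact Polynomial.monic_X_pow _
    · exact Polynomial.natDegree_X_pow _
  | succ m ih =>
    rw [triangularSystem, triangularSystem_X_succ]
    have hd : r * (a + 1) - 1 + 1 = r * (a + 1) := Nat.sub_add_cancel (by nlinarith)
    refine .snoc (d := r * (a + 1) - 1) (ih (a + 1)) ?_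
      (monic_finSuccEquiv_coeff_hSeries hr _ _) ?_ <;> rw [hd]
    · exact isHomogeneous_coeff_hSeries_X_pow _ _ _
    · exact natDegree_finSuccEquiv_coeff_hSeries hr _ _

/-! ### Colon ideals -/

/-- A relation `J : z ≤ J'` between ideals in `n` variables persists after adjoining a variable
`x_0` together with a polynomial `p` monic in it: divide by `p` and compare coefficients of the
remainder. -/
theorem mem_span_range_snoc_of_mul_rename_mem {n : ℕ} {F F' : Fin n → MvPolynomial (Fin n) K}
    {z : MvPolynomial (Fin n) K}
    (h : ∀ a, a * z ∈ Ideal.span (Set.range F) → a ∈ Ideal.span (Set.range F'))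
    {p b : MvPolynomial (Fin (n + 1)) K} (hp : (finSuccEquiv K n p).Monic)
    (hb : b * rename Fin.succ z ∈ Ideal.span (Set.range
      (Fin.snoc (α := fun _ => MvPolynomial (Fin (n + 1)) K) (fun i => rename Fin.succ (F i)) p))) :
    b ∈ Ideal.span (Set.range
      (Fin.snoc (α := fun _ => MvPolynomial (Fin (n + 1)) K)
        (fun i => rename Fin.succ (F' i)) p)) := by
  rw [mem_span_range_snoc_iff] at hb ⊢
  set J := Ideal.span (Set.range F)
  set J' := Ideal.span (Set.range F')
  set P := finSuccEquiv K n p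
  set u := finSuccEquiv K n b %ₘ P with hu
  have hdiv : finSuccEquiv K n b = u + P * (finSuccEquiv K n b /ₘ P) :=
    (Polynomial.modByMonic_add_div _ P).symm
  have hzero : (u * Polynomial.C z).map (Ideal.Quotient.mk J) = 0 := by
    rcases subsingleton_or_nontrivial (MvPolynomial (Fin n) K ⧸ J) with hs | hs
    · exact Subsingleton.elim _ _
    refine eq_zero_of_monic_dvd (hp.map (Ideal.Quotient.mk J)) ?_ ?_
    · rw [map_mul, finSuccEquiv_rename_succ, hdiv, add_mul, Polynomial.map_add, mul_assoc P,
        Polynomial.map_mul (p := P)] at hb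
      exact (dvd_add_left (dvd_mul_right _ _)).mp hb
    · rw [hp.degree_map]
      refine Polynomial.degree_map_le.trans_lt ?_
      refine lt_of_le_of_lt ?_ (Polynomial.degree_modByMonic_lt (finSuccEquiv K n b) hp)
      refine (Polynomial.degree_mul_le _ _).trans ?_
      exact add_le_of_nonpos_right Polynomial.degree_C_le
  have hu0 : u.map (Ideal.Quotient.mk J') = 0 := by
    ext k
    rw [Polynomial.coeff_map, Polynomial.coeff_zero, Ideal.Quotient.eq_zero_iff_mem]
    refine h _ ?_
    have := congrArg (fun v => Polynomial.coeff v k) hzero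
    simpa only [Polynomial.coeff_map, Polynomial.coeff_mul_C, Polynomial.coeff_zero,
      Ideal.Quotient.eq_zero_iff_mem] using this
  rw [hdiv, Polynomial.map_add, hu0, zero_add, Polynomial.map_mul]
  exact dvd_mul_right _ _

theorem mem_span_range_triangularSystem_of_mul_X_pow_mem {r : ℕ} (hr : 1 ≤ r) (t k m a : ℕ)
    {b : MvPolynomial (Fin (m + 1)) K}
    (hb : b * X (Fin.last m) ^ k ∈ Ideal.span (Set.range (triangularSystem r (t + k) a X))) :
    b ∈ Ideal.span (Set.range (triangularSystem r t a X)) := by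
  induction m generalizing a with
  | zero =>
    have hrange : ∀ t, Set.range (triangularSystem r t a (X : Fin 1 → MvPolynomial (Fin 1) K)) =
        {X 0 ^ t} := fun t => by
      ext z
      simp [triangularSystem]
    rw [hrange, Ideal.mem_span_singleton] at hb ⊢
    rw [pow_add] at hb
    exact (mul_dvd_mul_iff_right (pow_ne_zero k (X_ne_zero (0 : Fin 1)))).mp hb
  | succ m ih =>
    rw [triangularSystem, triangularSystem_X_succ] at hb ⊢
    rw [show (X (Fin.last (m + 1)) : MvPolynomial (Fin (m + 2)) K) ^ k =
      rename Fin.succ (X (Fin.last m) ^ k) by rw [map_pow, rename_X]; rfl] at hb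
    exact mem_span_range_snoc_of_mul_rename_mem (fun c hc => ih (a + 1) hc)
      (monic_finSuccEquiv_coeff_hSeries hr _ _) hb

/-- Passing from `A` to `A / (0 : x_n ^ k)` replaces the generator `x_n ^ (s n)` of the defining
ideal by `x_n ^ (s n - k)`. -/
theorem comap_annVarPow_last {r : ℕ} (hr : 1 ≤ r) (m s t k : ℕ) (hrs : r ∣ s)
    (ht : t + k = s * (m + 1)) :
    (annVarPow K r s (Fin.last m) k).comap (symmMk K (m + 1) r s) =
      Ideal.span (Set.range (triangularSystem r t 0 (X : Fin (m + 1) → _))) := by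
  have hmem : ∀ b, b ∈ (annVarPow K r s (Fin.last m) k).comap (symmMk K (m + 1) r s) ↔
      b * X (Fin.last m) ^ k ∈
        Ideal.span (Set.range (triangularSystem r (t + k) 0 (X : Fin (m + 1) → _))) := fun b => by
    rw [Ideal.mem_comap, annVarPow, Submodule.mem_colon_singleton, smul_eq_mul, Submodule.mem_bot,
      symmVar, ← map_pow, ← map_mul, ht, ← symmIdeal_eq_span_range_triangularSystem m r s hrs]
    exact Ideal.Quotient.eq_zero_iff_mem
  apply le_antisymm
  · intro b hb
    exact mem_span_range_triangularSystem_of_mul_X_pow_mem hr t k m 0 ((hmem b).mp hb)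
  · rw [span_range_triangularSystem, sup_le_iff, Ideal.span_singleton_le_iff_mem, hmem,
      ← pow_add, span_range_triangularSystem]
    refine ⟨fun b hb => ?_, Ideal.mem_sup_right (Ideal.mem_span_singleton_self _)⟩
    rw [hmem, span_range_triangularSystem]
    exact Ideal.mul_mem_right _ _ (Ideal.mem_sup_left hb)

end Symmetric

end

theorem mainTheorem10 {K : Type*} [Field K] [CharZero K] (n r s : ℕ) (hn : 1 ≤ n) (hr : 1 ≤ r)
    (hs : 1 ≤ s) (hrs : r ∣ s) (k : ℕ) (hk : 1 ≤ k) (hksn : k < s * n) :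
    let last : Fin n := ⟨n - 1, by omega⟩
    IsCompleteIntersection
      ((annVarPow K r s last k).comap (symmMk K n r s)) ∧
    FiniteDimensional K (SymmAlgebra K n r s ⧸ annVarPow K r s last k) ∧
    HasSLP (annVarPowGrading K r s last k) := by
  obtain ⟨m, rfl⟩ : ∃ m, n = m + 1 := ⟨n - 1, by omega⟩
  intro last
  have hlast : last = Fin.last m := rfl
  clear_value last
  subst hlast
  have hJt := comap_annVarPow_last (K := K) hr m s (s * (m + 1) - k) k hrs (by omega)
  have htri := isTriangular_triangularSystem (K := K) r (s * (m + 1) - k) hr (by omega) m 0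
  obtain ⟨hfin, c, g, hg⟩ := htri.exists_isLefschetz
  let Φ : MvPolynomial (Fin (m + 1)) K →ₐ[K]
      SymmAlgebra K (m + 1) r s ⧸ annVarPow K r s (Fin.last m) k :=
    (Ideal.Quotient.mkₐ K _).comp (symmMk K (m + 1) r s)
  have hΦ : Function.Surjective Φ :=
    (Ideal.Quotient.mkₐ_surjective K _).comp (Ideal.Quotient.mkₐ_surjective K _)
  have hker : RingHom.ker Φ = Ideal.span (Set.range
      (triangularSystem r (s * (m + 1) - k) 0 (X : Fin (m + 1) → _))) := by
    rw [← hJt]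
    ext b
    rw [RingHom.mem_ker, Ideal.mem_comap]
    exact Ideal.Quotient.eq_zero_iff_mem
  have hfin' : FiniteDimensional K (SymmAlgebra K (m + 1) r s ⧸ annVarPow K r s (Fin.last m) k) :=
    Module.Finite.equiv ((Ideal.quotientEquivAlgOfEq K hker.symm).trans
      (Ideal.quotientKerAlgEquivOfSurjective hΦ)).toLinearEquiv
  obtain ⟨g', hg'⟩ := hg.map_of_ker_eq hΦ hker
  have hgrad : (fun i => (homogeneousSubmodule (Fin (m + 1)) K i).map Φ.toLinearMap) =
      annVarPowGrading K r s (Fin.last m) k := by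
    funext i
    exact Submodule.map_comp (symmMk K (m + 1) r s).toLinearMap
      (Ideal.Quotient.mkₐ K _).toLinearMap _
  rw [hgrad] at hg'
  refine ⟨hJt ▸ htri.isCompleteIntersection, hfin', c, hg'.top_ne_bot, hg'.eq_bot, g', hg'.mem,
    fun i hi => hg'.bijOn hi⟩
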